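/- Let $X$ be a compact connected Riemann surface with holomorphic tangent bundle $TX$ and structure sheaf $\mathcal O_X$, and let $E\neq 0$ be a holomorphic vector bundle on $X$. Let $(V,\phi)$ be a holomorphic Lie algebroid on $X$ with $\phi\neq 0$: $V$ is a holomorphic vector bundle whose sheaf of sections carries a $\mathbb C$-bilinear Lie bracket, and the anchor $\phi:V\to TX$ is an $\mathcal O_X$-linear map with $[s,ft]=f[s,t]+\phi(s)(f)\,t$ for local sections $s,t$ of $V$ and local holomorphic functions $f$. Definitions. $\mathrm{Diff}^1(E,G)$ is the sheaf of holomorphic differential operators $E\to G$ of order at most one, an $\mathcal O_X$-module by $(fP)(s)=f\,P(s)$. The symbol of $P$ is the section of $\mathrm{Hom}(E,G)\otimes TX$ which pairs with $df$ to the homomorphism $s\mapsto P(fs)-fP(s)$. Let $\sigma$ be the symbol map on $\mathrm{Diff}^1(E,E\otimes V^*)$ and $\sigma_0$ that on $\mathrm{Diff}^1(E,E)$. View $\phi$ as a section of $TX\otimes V^*$, and let $\mathrm{Diff}^1_1(E,E\otimes V^*)$ be the subsheaf of those $P$ with $\sigma(P)=f\cdot(\mathrm{Id}_E\otimes\phi)$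 for some holomorphic function $f=:\widehat\sigma(P)$. It contains $\mathrm{End}(E)\otimes V^*$, as the operators of order zero; let $\iota:\mathrm{End}(E)\otimes V^*\otimes V\to \mathrm{Diff}^1_1(E,E\otimes V^*)\otimes V$ be the induced map, and let $\mathrm{End}^0(V)\subset\mathrm{End}(V)=V^*\otimes V$ be the traceless endomorphisms. Put $$\mathcal A_E=\big(\mathrm{Diff}^1_1(E,E\otimes V^*)\otimes V\big)/\iota\big(\mathrm{End}(E)\otimes \mathrm{End}^0(V)\big),\qquad \mathrm{At}(E)=\sigma_0^{-1}(\mathrm{Id}_E\otimes TX)\subset\mathrm{Diff}^1(E,E).$$ A Lie algebroid connection on $E$ is a global holomorphic differential operator $D:E\to E\otimes V^*$ of order at most one with $D(fs)=fD(s)+s\otimes\phi^*(df)$ for local sections $s$ of $E$ and local holomorphic functions $f$. Then: 1. $\mathcal A_E$ is locally free of rank $(\mathrm{rk}\,E)^2+\mathrm{rk}\,V$, and there are homomorphisms $j,\rho$ of $\mathcal O_X$-modules forming a short exact sequence (the generalized Atiyah exact sequence) $$0\to\mathrm{End}(E)\xrightarrow{\,j\,}\mathcal A_E\xrightarrow{\,\rho\,}V\to0,$$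 where $\rho([P\otimes v])=\widehat\sigma(P)\,v$, and $j$ is induced by $\iota$ and the isomorphism $\mathrm{End}(E)\otimes\mathrm{End}(V)/\mathrm{End}(E)\otimes\mathrm{End}^0(V)\cong\mathrm{End}(E)$ given by the trace on $\mathrm{End}(V)$, that is, $j(\beta(v)A)=[(A\otimes\beta)\otimes v]$ for local sections $A$ of $\mathrm{End}(E)$, $\beta$ of $V^*$ and $v$ of $V$. 2. The sequence $0\to\mathrm{End}(E)\to\mathrm{At}(E)\xrightarrow{\sigma_0}TX\to0$ is exact (the first map is the inclusion of the operators of order zero, and $\mathrm{Id}_E\otimes TX$ is identified with $TX$), and there is a homomorphism $\varphi:\mathcal A_E\to\mathrm{At}(E)$, given by the contraction $\varphi([P\otimes v])(s)=\langle v,P(s)\rangle$, such that the diagram $$\begin{matrix}0&\to&\mathrm{End}(E)&\xrightarrow{\,j\,}&\mathcal A_E&\xrightarrow{\,\rho\,}&V&\to&0\\&&\Vert&&\downarrow\varphi&&\downarrow\phi\\0&\to&\mathrm{End}(E)&\to&\mathrm{At}(E)&\xrightarrow{\sigma_0}&TX&\to&0\end{matrix}$$ commutes. 3. The Lie algebroid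 connections $D$ on $E$ are in bijection with the homomorphisms $\delta:V\to\mathcal A_E$ of $\mathcal O_X$-modules such that $\rho\circ\delta=\mathrm{Id}_V$. The bijection sends $D$ to $\delta(v)=[D\otimes v]$, and its inverse sends $\delta$ to the operator $D$ with $\langle v,D(s)\rangle=\varphi(\delta(v))(s)$, for local sections $v$ of $V$ and $s$ of $E$. -/

import Mathlib

open CategoryTheory TopologicalSpace Opposite
open scoped Manifold ContDiff Bundle TensorProduct

universe u v w w₁ w₂

noncomputable section

namespace RiemannSurface

section Functions
variable {X : Type u} [TopologicalSpace X] [ChartedSpace ℂ X]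

/-- The algebra `𝒪(U)` of holomorphic functions on the open set `U`. -/
def holFun (U : Opens X) : Subalgebra ℂ (U → ℂ) where
  carrier := {f | ContMDiff 𝓘(ℂ) 𝓘(ℂ) ω f}
  mul_mem' hf hg := ContMDiff.mul hf hg
  add_mem' hf hg := ContMDiff.add hf hg
  algebraMap_mem' _ := contMDiff_const

/-- Restriction of holomorphic functions. -/
def resFun {W U : Opens X} (h : W ≤ U) : holFun U →+* holFun W where
  toFun f := ⟨fun x => f.1 ⟨x.1, h x.2⟩, ContMDiff.comp f.2 (contMDiff_inclusion h)⟩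
  map_one' := rfl
  map_mul' _ _ := rfl
  map_zero' := rfl
  map_add' _ _ := rfl

/-- The differential at `x` of a holomorphic function `f` on `U`, as a linear form on `T_x X`. -/
def dAt {U : Opens X} (f : holFun U) (x : U) : TangentSpace 𝓘(ℂ) x.1 →L[ℂ] ℂ :=
  mfderiv 𝓘(ℂ) 𝓘(ℂ) (Function.extend Subtype.val f.1 0) x.1

lemma dAt_res {W U : Opens X} (h : W ≤ U) (f : holFun U) (x : X) (hx : x ∈ W) :
    dAt (resFun h f) ⟨x, hx⟩ = dAt f ⟨x, h hx⟩ := by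
  refine Filter.EventuallyEq.mfderiv_eq ?_
  filter_upwards [W.2.mem_nhds hx] with y hy
  have e1 := Subtype.val_injective.extend_apply (resFun h f).1 0 ⟨y, hy⟩
  have e2 := Subtype.val_injective.extend_apply f.1 0 ⟨y, h hy⟩
  exact e1.trans e2.symm

/-- Being holomorphic (as a map from an open set) is a local property. -/
lemma contMDiff_of_local {M' H' E' : Type*} [NormedAddCommGroup E'] [NormedSpace ℂ E']
    [TopologicalSpace H'] {I' : ModelWithCorners ℂ E' H'} [TopologicalSpace M']
    [ChartedSpace H' M'] {U : Opens X} (f : U → M')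
    (hf : ∀ x : U, ∃ (W : Opens X) (h : W ≤ U), x.1 ∈ W ∧
      ContMDiff 𝓘(ℂ) I' ω (f ∘ Set.inclusion h : W → M')) : ContMDiff 𝓘(ℂ) I' ω f := by
  intro x
  obtain ⟨W, h, hx, hW⟩ := hf x
  have := hW ⟨x.1, hx⟩
  exact ((contDiffWithinAt_localInvariantProp (I := 𝓘(ℂ)) (I' := I') ω).liftPropAt_iff_comp_inclusion
    h f ⟨x.1, hx⟩).2 this

end Functions

/-- A holomorphic vector bundle of finite rank on `X`, with typical fibre `F` and fibres `fib x`. -/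
structure HolVB (X : Type u) [TopologicalSpace X] [ChartedSpace ℂ X] where
  F : Type w
  fib : X → Type w
  [normF : NormedAddCommGroup F]
  [spaceF : NormedSpace ℂ F]
  [finF : FiniteDimensional ℂ F]
  [grp : ∀ x, AddCommGroup (fib x)]
  [mod : ∀ x, Module ℂ (fib x)]
  [top : ∀ x, TopologicalSpace (fib x)]
  [topGrp : ∀ x, IsTopologicalAddGroup (fib x)]
  [topSmul : ∀ x, ContinuousSMul ℂ (fib x)]
  [total : TopologicalSpace (Bundle.TotalSpace F fib)]
  [bundle : FiberBundle F fib]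
  [vector : VectorBundle ℂ F fib]
  [hol : ContMDiffVectorBundle ω F fib 𝓘(ℂ)]

namespace HolVB
attribute [instance] normF spaceF finF grp mod top topGrp topSmul total bundle vector hol

variable {X : Type u} [TopologicalSpace X] [ChartedSpace ℂ X]

/-- The bundle `Hom(V, E) = E ⊗ V^*`. -/
def Hom (V : HolVB.{u, w₁} X) (E : HolVB.{u, w₂} X) : HolVB.{u, max w₁ w₂} X where
  F := V.F →L[ℂ] E.F
  fib x := V.fib x →L[ℂ] E.fib x

/-- The trivial line bundle. -/
def trivial (X : Type u) [TopologicalSpace X] [ChartedSpace ℂ X] : HolVB.{u, 0} X where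
  F := ℂ
  fib := Bundle.Trivial X ℂ

/-- The holomorphic tangent bundle `TX`. -/
def tangent (X : Type u) [TopologicalSpace X] [ChartedSpace ℂ X] [IsManifold 𝓘(ℂ) ω X] :
    HolVB.{u, 0} X where
  F := ℂ
  fib x := TangentSpace 𝓘(ℂ) x

variable (E : HolVB.{u, w} X)

/-- The holomorphic sections of `E` over `U`. -/
def sec (U : Opens X) : Submodule (holFun U) (∀ x : U, E.fib x) where
  carrier := {s | ContMDiff 𝓘(ℂ) (𝓘(ℂ).prod 𝓘(ℂ, E.F)) ω
    (fun x : U => (⟨x.1, s x⟩ : Bundle.TotalSpace E.F E.fib))}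
  add_mem' {s t} hs ht := by
    intro x
    have hs := Bundle.contMDiffAt_totalSpace.1 (hs x)
    have ht := Bundle.contMDiffAt_totalSpace.1 (ht x)
    refine Bundle.contMDiffAt_totalSpace.2 ⟨hs.1, (hs.2.add ht.2).congr_of_eventuallyEq ?_⟩
    have : ∀ᶠ y : U in nhds x, y.1 ∈ (trivializationAt E.F E.fib x.1).baseSet :=
      continuous_subtype_val.continuousAt.eventually
        ((trivializationAt E.F E.fib x.1).open_baseSet.mem_nhds
          (FiberBundle.mem_baseSet_trivializationAt' x.1))
    filter_upwards [this] with y hy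
    exact ((trivializationAt E.F E.fib x.1).linear ℂ hy).1 _ _
  zero_mem' := (Bundle.contMDiff_zeroSection ℂ E.fib).comp contMDiff_subtype_val
  smul_mem' f s hs := by
    intro x
    have hs := Bundle.contMDiffAt_totalSpace.1 (hs x)
    have hf : ContMDiff 𝓘(ℂ) 𝓘(ℂ) ω f.1 := f.2
    refine Bundle.contMDiffAt_totalSpace.2 ⟨hs.1, ((hf x).smul hs.2).congr_of_eventuallyEq ?_⟩
    have : ∀ᶠ y : U in nhds x, y.1 ∈ (trivializationAt E.F E.fib x.1).baseSet :=
      continuous_subtype_val.continuousAt.eventually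
        ((trivializationAt E.F E.fib x.1).open_baseSet.mem_nhds
          (FiberBundle.mem_baseSet_trivializationAt' x.1))
    filter_upwards [this] with y hy
    exact ((trivializationAt E.F E.fib x.1).linear ℂ hy).2 _ _

variable {E}

instance (U : Opens X) : AddCommGroup (E.sec U) := Submodule.addCommGroup _
instance (U : Opens X) : Module (holFun U) (E.sec U) := Submodule.module _
instance (U : Opens X) : SMul (holFun U) (E.sec U) := (inferInstance : Module _ _).toSMul
instance (U : Opens X) : Module ℂ (E.sec U) := Submodule.module' _
instance (U : Opens X) : SMul ℂ (E.sec U) := (inferInstance : Module _ _).toSMul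

@[ext] lemma sec_ext {U : Opens X} {s t : E.sec U} (h : ∀ x, s.1 x = t.1 x) : s = t :=
  Subtype.ext (funext h)

instance (U : Opens X) : SMulCommClass (holFun U) ℂ (E.sec U) :=
  ⟨fun f c s => sec_ext fun x => smul_comm (f.1 x) c (s.1 x)⟩
instance (U : Opens X) : IsScalarTower ℂ (holFun U) (E.sec U) :=
  ⟨fun c f s => sec_ext fun x => smul_assoc c (f.1 x) (s.1 x)⟩

/-- Restriction of sections. -/
def res {W U : Opens X} (h : W ≤ U) : E.sec U →ₛₗ[resFun h] E.sec W where
  toFun s := ⟨fun x => s.1 ⟨x.1, h x.2⟩, ContMDiff.comp s.2 (contMDiff_inclusion h)⟩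
  map_add' _ _ := rfl
  map_smul' _ _ := rfl

lemma mem_sec_of_local {U : Opens X} (s : ∀ x : U, E.fib x)
    (hs : ∀ x : U, ∃ (W : Opens X) (h : W ≤ U), x.1 ∈ W ∧
      (fun y : W => s ⟨y.1, h y.2⟩) ∈ E.sec W) : s ∈ E.sec U :=
  contMDiff_of_local _ hs

lemma sec_glue {ι : Type*} (U : ι → Opens X) (s : ∀ i, E.sec (U i))
    (hs : ∀ i j, res (inf_le_left : U i ⊓ U j ≤ U i) (s i) = res inf_le_right (s j)) :
    ∃! t : E.sec (iSup U), ∀ i, res (le_iSup U i) t = s i := by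
  have key : ∀ i j (x : X) (hi : x ∈ U i) (hj : x ∈ U j), (s i).1 ⟨x, hi⟩ = (s j).1 ⟨x, hj⟩ := by
    intro i j x hi hj
    exact congrFun (congrArg Subtype.val (hs i j)) ⟨x, hi, hj⟩
  choose c hc using fun x : ↥(iSup U) => Opens.mem_iSup.1 x.2
  refine ⟨⟨fun x => (s (c x)).1 ⟨x.1, hc x⟩, mem_sec_of_local _ fun x =>
    ⟨U (c x), le_iSup U _, hc x, ?_⟩⟩, ?_, ?_⟩
  · convert (s (c x)).2 using 2 with y
    exact key _ _ _ _ _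
  · intro i
    ext x
    exact key _ _ _ _ _
  · intro t ht
    ext x
    exact congrFun (congrArg Subtype.val (ht (c x))) ⟨x.1, hc x⟩

end HolVB


namespace HolVB
variable {X : Type u} [TopologicalSpace X] [ChartedSpace ℂ X]
variable {V : HolVB.{u, w₁} X} {E : HolVB.{u, w₂} X} {U : Opens X}

/-- The value at a point of a section of `Hom(V, E)`. -/
def homAt (A : (V.Hom E).sec U) (x : U) : V.fib x →L[ℂ] E.fib x := A.1 x

/-- Applying a holomorphic section of `Hom(V, E)` to sections of `V`. -/
def appHom (A : (V.Hom E).sec U) : V.sec U →ₗ[holFun U] E.sec U where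
  toFun s := ⟨fun x => homAt A x (s.1 x),
    ContMDiff.clm_bundle_apply (F₁ := V.F) (E₁ := V.fib) (F₂ := E.F) (E₂ := E.fib)
      (b := fun x : U => x.1) (ϕ := fun x => homAt A x) A.2 s.2⟩
  map_add' s t := by
    ext x
    exact map_add (homAt A x) _ _
  map_smul' f s := by
    ext x
    exact map_smul (homAt A x) _ _

/-- The value at a point of a section of `V^* = Hom(V, 𝒪)`. -/
def covAt (β : (V.Hom (trivial X)).sec U) (x : U) : V.fib x →L[ℂ] ℂ := β.1 x

/-- The pairing of a section `β` of `V^*` with a section of `V`. -/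
def pair (β : (V.Hom (trivial X)).sec U) : V.sec U →ₗ[holFun U] holFun U where
  toFun v := ⟨fun x => covAt β x (v.1 x), by
    intro x
    have := Bundle.contMDiffAt_totalSpace.1 ((appHom β v).2 x)
    exact this.2⟩
  map_add' s t := Subtype.ext (funext fun x => (covAt β x).map_add _ _)
  map_smul' f s := Subtype.ext (funext fun x => (covAt β x).map_smul _ _)

/-- The section `e ⊗ β : v ↦ β(v) e` of `E ⊗ V^* = Hom(V, E)`. -/
def tens (e : E.sec U) (β : (V.Hom (trivial X)).sec U) : (V.Hom E).sec U :=
  ⟨fun x => (ContinuousLinearMap.smulRight (covAt β x) (e.1 x) :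
      V.fib x →L[ℂ] E.fib x), by
    intro x
    have hβ := (contMDiffAt_hom_bundle (F₁ := V.F) (E₁ := V.fib) (F₂ := ℂ)
      (E₂ := Bundle.Trivial X ℂ) _).1 (β.2 x)
    have he := Bundle.contMDiffAt_totalSpace.1 (e.2 x)
    refine (contMDiffAt_hom_bundle (F₁ := V.F) (E₁ := V.fib) (F₂ := E.F) (E₂ := E.fib) _).2
      ⟨hβ.1, ?_⟩
    have key := ((ContinuousLinearMap.smulRightL ℂ V.F E.F).contMDiff.contMDiffAt.comp x hβ.2).clm_apply he.2
    refine key.congr_of_eventuallyEq ?_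
    have h1 : ∀ᶠ y : U in nhds x, y.1 ∈ (trivializationAt E.F E.fib x.1).baseSet :=
      continuous_subtype_val.continuousAt.eventually
        ((trivializationAt E.F E.fib x.1).open_baseSet.mem_nhds
          (FiberBundle.mem_baseSet_trivializationAt' x.1))
    have h2 : ∀ᶠ y : U in nhds x, y.1 ∈ (trivializationAt V.F V.fib x.1).baseSet :=
      continuous_subtype_val.continuousAt.eventually
        ((trivializationAt V.F V.fib x.1).open_baseSet.mem_nhds
          (FiberBundle.mem_baseSet_trivializationAt' x.1))
    filter_upwards [h1, h2] with y hy1 hy2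
    ext z
    have T : (trivializationAt ℂ (Bundle.Trivial X ℂ) x.1).continuousLinearMapAt ℂ y.1 =
      ContinuousLinearMap.id ℂ ℂ := Bundle.Trivial.continuousLinearMapAt_trivialization ℂ X ℂ y.1
    simp only [Function.comp, ContinuousLinearMap.inCoordinates, T]
    change (trivializationAt E.F E.fib x.1).continuousLinearMapAt ℂ y.1
        (covAt β y ((trivializationAt V.F V.fib x.1).symmL ℂ y.1 z) • e.1 y) =
      (covAt β y ((trivializationAt V.F V.fib x.1).symmL ℂ y.1 z)) •
        (trivializationAt E.F E.fib x.1 ⟨y.1, e.1 y⟩).2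
    rw [map_smul, Bundle.Trivialization.continuousLinearMapAt_apply_of_mem _ _ hy1]⟩

/-- The map `e ↦ e ⊗ β`. -/
def tensRight (β : (V.Hom (trivial X)).sec U) : E.sec U →ₗ[holFun U] (V.Hom E).sec U where
  toFun e := tens e β
  map_add' e e' := sec_ext fun x => ContinuousLinearMap.ext fun v =>
    smul_add (covAt β x v) (e.1 x) (e'.1 x)
  map_smul' f e := sec_ext fun x => ContinuousLinearMap.ext fun v =>
    smul_comm (covAt β x v) (f.1 x) (e.1 x)

lemma tens_add (e : E.sec U) (β β' : (V.Hom (trivial X)).sec U) :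
    tens e (β + β') = tens e β + tens e β' :=
  sec_ext fun x => ContinuousLinearMap.ext fun v => add_smul (covAt β x v) (covAt β' x v) (e.1 x)

lemma tens_smul (f : holFun U) (e : E.sec U) (β : (V.Hom (trivial X)).sec U) :
    tens e (f • β) = f • tens e β :=
  sec_ext fun x => ContinuousLinearMap.ext fun v => mul_smul (f.1 x) (covAt β x v) (e.1 x)

end HolVB

section Sheaves
variable (X : Type u) [TopologicalSpace X] [ChartedSpace ℂ X]

/-- The presheaf of rings of holomorphic functions. -/
def holPresheaf : TopCat.Presheaf RingCat.{u} (TopCat.of X) where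
  obj U := RingCat.of (holFun (X := X) U.unop)
  map h := RingCat.ofHom (resFun (leOfHom h.unop))
  map_id _ := rfl
  map_comp _ _ := rfl

/-- The sheaf of rings `𝒪_X`. -/
def holSheaf : Sheaf (Opens.grothendieckTopology (TopCat.of X)) RingCat.{u} where
  obj := holPresheaf X
  property := by
    refine (TopCat.Presheaf.isSheaf_iff_isSheafUniqueGluing _).2 ?_
    intro ι U s hs
    have key : ∀ i j (x : X) (hi : x ∈ U i) (hj : x ∈ U j),
        (show holFun (X := X) (U i) from s i).1 ⟨x, hi⟩ =
          (show holFun (X := X) (U j) from s j).1 ⟨x, hj⟩ := by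
      intro i j x hi hj
      exact congrFun (congrArg Subtype.val (hs i j)) ⟨x, hi, hj⟩
    choose c hc using fun x : ↥(iSup U) => Opens.mem_iSup.1 x.2
    refine ⟨(⟨fun x => (show holFun (X := X) _ from s (c x)).1 ⟨x.1, hc x⟩,
      contMDiff_of_local _ fun x => ⟨U (c x), le_iSup U _, hc x, ?_⟩⟩ : holFun (X := X) (iSup U)),
      ?_, ?_⟩
    · have h2 := (show holFun (X := X) _ from s (c x)).2
      have h3 : (fun y : U (c x) => (show holFun (X := X) _ from s (c ⟨y.1, le_iSup U (c x) y.2⟩)).1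
          ⟨y.1, hc ⟨y.1, le_iSup U (c x) y.2⟩⟩) =
          (show holFun (X := X) (U (c x)) from s (c x)).1 := funext fun y => key _ _ _ _ _
      exact (congrArg (ContMDiff 𝓘(ℂ) 𝓘(ℂ) ω) h3).mpr h2
    · intro i
      refine Subtype.ext (funext fun x => ?_)
      exact key _ _ _ _ _
    · intro t ht
      refine Subtype.ext (funext fun x => ?_)
      exact congrFun (congrArg Subtype.val (ht (c x))) ⟨x.1, hc x⟩

variable {X}

/-- The presheaf of `𝒪_X`-modules with given sections and restriction maps. -/
def mkPresheaf (M : Opens X → Type v) [∀ U, AddCommGroup (M U)] [mod : ∀ U, Module (holFun U) (M U)]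
    (r : ∀ {W U : Opens X} (h : W ≤ U), M U →ₛₗ[resFun h] M W)
    (r_id : ∀ (U : Opens X) (s : M U), r le_rfl s = s)
    (r_comp : ∀ {W V U : Opens X} (h : W ≤ V) (k : V ≤ U) (s : M U),
      r h (r k s) = r (h.trans k) s) :
    PresheafOfModules.{v} (holSheaf X).obj :=
  @PresheafOfModules.ofPresheaf _ _ (holSheaf X).obj
    { obj := fun U => AddCommGrpCat.of (M U.unop)
      map := fun h => AddCommGrpCat.ofHom (r (leOfHom h.unop)).toAddMonoidHom
      map_id := fun U => by
        ext s
        exact r_id _ s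
      map_comp := fun h k => by
        ext s
        exact (r_comp _ _ s).symm }
    (fun U => mod U.unop)
    fun _ _ h f s => (r (leOfHom h.unop)).map_smul' f s

/-- The sheaf of `𝒪_X`-modules with given sections and restriction maps, when sections glue. -/
def mkSheaf (M : Opens X → Type (max u v)) [∀ U, AddCommGroup (M U)] [∀ U, Module (holFun U) (M U)]
    (r : ∀ {W U : Opens X} (h : W ≤ U), M U →ₛₗ[resFun h] M W)
    (r_id : ∀ (U : Opens X) (s : M U), r le_rfl s = s)
    (r_comp : ∀ {W V U : Opens X} (h : W ≤ V) (k : V ≤ U) (s : M U),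
      r h (r k s) = r (h.trans k) s)
    (glue : ∀ {ι : Type u} (U : ι → Opens X) (s : ∀ i, M (U i)),
      (∀ i j, r (inf_le_left : U i ⊓ U j ≤ U i) (s i) = r inf_le_right (s j)) →
        ∃! t : M (iSup U), ∀ i, r (le_iSup U i) t = s i) :
    SheafOfModules.{max u v} (holSheaf X) where
  val := mkPresheaf M r r_id r_comp
  isSheaf := by
    refine (TopCat.Presheaf.isSheaf_iff_isSheafUniqueGluing
      (X := TopCat.of X) (C := AddCommGrpCat.{max u v}) _).2 ?_
    intro ι U s hs
    exact glue U s hs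

/-- The sheaf of holomorphic sections of a holomorphic vector bundle. -/
def HolVB.sheaf (E : HolVB.{u, w} X) : SheafOfModules.{max u w} (holSheaf X) :=
  mkSheaf.{u, w} (fun U => E.sec U) (fun h => HolVB.res h) (fun _ _ => rfl) (fun _ _ _ => rfl)
    (fun U s hs => HolVB.sec_glue U s hs)

end Sheaves

section DiffOps
variable {X : Type u} [TopologicalSpace X] [ChartedSpace ℂ X]
open HolVB

/-- Holomorphic differential operators of order (at most) one from `E` to `G` over `U`, that is,
the sections over `U` of `Diff¹(E, G)`: `ℂ`-linear morphisms of sheaves `P : E|_U → G|_U` such that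
`[[P, f], g] = 0` for all local holomorphic functions `f`, `g`. -/
@[ext]
structure DiffOp (E : HolVB.{u, w₁} X) (G : HolVB.{u, w₂} X) (U : Opens X) where
  toFun : ∀ W : Opens X, W ≤ U → E.sec W → G.sec W
  map_add : ∀ W h s t, toFun W h (s + t) = toFun W h s + toFun W h t
  map_smul : ∀ W h (c : ℂ) s, toFun W h (c • s) = c • toFun W h s
  map_res : ∀ W' W (k : W' ≤ W) (h : W ≤ U) s,
    toFun W' (k.trans h) (res k s) = res k (toFun W h s)
  order_le_one : ∀ W h (f g : holFun W) s,
    toFun W h (f • g • s) - f • toFun W h (g • s) - g • toFun W h (f • s)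
      + f • g • toFun W h s = 0

namespace DiffOp
variable {E : HolVB.{u, w₁} X} {G : HolVB.{u, w₂} X} {U : Opens X}

instance : Zero (DiffOp E G U) where
  zero :=
    { toFun := fun _ _ _ => 0
      map_add := by simp
      map_smul := by simp
      map_res := by simp
      order_le_one := fun W h f g s => by simp only [smul_zero]; abel }

instance : Add (DiffOp E G U) where
  add P Q :=
    { toFun := fun W h s => P.toFun W h s + Q.toFun W h s
      map_add := fun W h s t => by rw [P.map_add, Q.map_add]; abel
      map_smul := fun W h c s => by rw [P.map_smul, Q.map_smul, smul_add]
      map_res := fun W' W k h s => by rw [P.map_res, Q.map_res, _root_.map_add]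
      order_le_one := fun W h f g s => by
        have := congrArg₂ (· + ·) (P.order_le_one W h f g s) (Q.order_le_one W h f g s)
        simp only [add_zero] at this
        rw [← this]
        simp only [smul_add]
        abel }

instance : Neg (DiffOp E G U) where
  neg P :=
    { toFun := fun W h s => -P.toFun W h s
      map_add := fun W h s t => by rw [P.map_add]; abel
      map_smul := fun W h c s => by
        rw [P.map_smul]; exact (smul_neg c _).symm
      map_res := fun W' W k h s => by
        rw [P.map_res W' W k h]; exact (_root_.map_neg (HolVB.res k) _).symm
      order_le_one := fun W h f g s => by
        have := congrArg Neg.neg (P.order_le_one W h f g s)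
        simp only [neg_zero] at this
        rw [← this]
        simp only [smul_neg]
        abel }

/-- The module structure `(f P)(s) = f · P(s)`. -/
instance : SMul (holFun U) (DiffOp E G U) where
  smul a P :=
    { toFun := fun W h s => resFun h a • P.toFun W h s
      map_add := fun W h s t => by rw [P.map_add, smul_add]
      map_smul := fun W h c s => by rw [P.map_smul, smul_comm]
      map_res := fun W' W k h s => by rw [P.map_res, map_smulₛₗ]; rfl
      order_le_one := fun W h f g s => by
        have := congrArg (resFun h a • ·) (P.order_le_one W h f g s)
        simp only [smul_zero] at this
        rw [← this]
        simp only [smul_add, smul_sub, smul_smul]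
        congr 2 <;> ring_nf }

@[simp] lemma add_toFun (P Q : DiffOp E G U) (W h s) :
    (P + Q).toFun W h s = P.toFun W h s + Q.toFun W h s := rfl
@[simp] lemma neg_toFun (P : DiffOp E G U) (W h s) : (-P).toFun W h s = -P.toFun W h s := rfl
@[simp] lemma zero_toFun (W h s) : (0 : DiffOp E G U).toFun W h s = 0 := rfl
@[simp] lemma smul_toFun (a : holFun U) (P : DiffOp E G U) (W h s) :
    (a • P).toFun W h s = resFun h a • P.toFun W h s := rfl

lemma ext' {P Q : DiffOp E G U} (h : ∀ W k s, P.toFun W k s = Q.toFun W k s) : P = Q :=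
  DiffOp.ext (funext fun W => funext fun k => funext fun s => h W k s)

instance : AddCommGroup (DiffOp E G U) where
  add_assoc P Q R := ext' fun _ _ _ => add_assoc _ _ _
  zero_add P := ext' fun _ _ _ => zero_add _
  add_zero P := ext' fun _ _ _ => add_zero _
  neg_add_cancel P := ext' fun W h s => neg_add_cancel (P.toFun W h s)
  add_comm P Q := ext' fun _ _ _ => add_comm _ _
  nsmul := nsmulRec
  zsmul := zsmulRec

instance : Module (holFun U) (DiffOp E G U) where
  one_smul P := ext' fun _ _ _ => by simp
  mul_smul a b P := ext' fun _ _ _ => by simp [mul_smul]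
  smul_zero a := ext' fun _ _ _ => by simp
  smul_add a P Q := ext' fun _ _ _ => by simp
  add_smul a b P := ext' fun _ _ _ => by simp [add_smul]
  zero_smul P := ext' fun _ _ _ => by simp

/-- Restriction of differential operators. -/
def res {W U : Opens X} (h : W ≤ U) : DiffOp E G U →ₛₗ[resFun h] DiffOp E G W where
  toFun P :=
    { toFun := fun W' k s => P.toFun W' (k.trans h) s
      map_add := fun _ _ _ _ => P.map_add _ _ _ _
      map_smul := fun _ _ _ _ => P.map_smul _ _ _ _
      map_res := fun _ _ _ _ _ => P.map_res _ _ _ _ _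
      order_le_one := fun _ _ _ _ _ => P.order_le_one _ _ _ _ _ }
  map_add' _ _ := rfl
  map_smul' _ _ := rfl

lemma glue {ι : Type*} (U : ι → Opens X) (P : ∀ i, DiffOp E G (U i))
    (hP : ∀ i j, res (inf_le_left : U i ⊓ U j ≤ U i) (P i) = res inf_le_right (P j)) :
    ∃! Q : DiffOp E G (iSup U), ∀ i, res (le_iSup U i) Q = P i := by
  have key0 : ∀ i j W (h : W ≤ U i ⊓ U j) s, (P i).toFun W (h.trans inf_le_left) s =
      (P j).toFun W (h.trans inf_le_right) s := fun i j W h s => by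
    have := congrArg (fun Q : DiffOp E G (U i ⊓ U j) => Q.toFun W h s) (hP i j)
    exact this
  have key1 : ∀ i W W' (k : W' ≤ W) (h : W ≤ U i) s (x : X) (hx : x ∈ W'),
      ((P i).toFun W' (k.trans h) (HolVB.res k s)).1 ⟨x, hx⟩ =
        ((P i).toFun W h s).1 ⟨x, k hx⟩ := fun i W W' k h s x hx => by
    rw [(P i).map_res]; rfl
  have key : ∀ i j W s (x : X) (hx : x ∈ W) (hi : x ∈ U i) (hj : x ∈ U j),
      ((P i).toFun (W ⊓ U i) inf_le_right (HolVB.res inf_le_left s)).1 ⟨x, hx, hi⟩ =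
        ((P j).toFun (W ⊓ U j) inf_le_right (HolVB.res inf_le_left s)).1 ⟨x, hx, hj⟩ := by
    intro i j W s x hx hi hj
    have e1 := key1 i (W ⊓ U i) (W ⊓ (U i ⊓ U j)) (inf_le_inf_left _ inf_le_left) inf_le_right
      (HolVB.res inf_le_left s) x ⟨hx, hi, hj⟩
    have e2 := key1 j (W ⊓ U j) (W ⊓ (U i ⊓ U j)) (inf_le_inf_left _ inf_le_right) inf_le_right
      (HolVB.res inf_le_left s) x ⟨hx, hi, hj⟩
    rw [← e1, ← e2]
    exact congrArg (fun t : G.sec (W ⊓ (U i ⊓ U j)) => t.1 ⟨x, hx, hi, hj⟩)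
      (key0 i j (W ⊓ (U i ⊓ U j)) inf_le_right (HolVB.res inf_le_left s))
  choose c hc using fun x : ↥(iSup U) => Opens.mem_iSup.1 x.2
  let F : ∀ W : Opens X, W ≤ iSup U → E.sec W → ∀ x : W, G.fib x := fun W h s x =>
    ((P (c ⟨x.1, h x.2⟩)).toFun (W ⊓ U (c ⟨x.1, h x.2⟩)) inf_le_right
      (HolVB.res inf_le_left s)).1 ⟨x.1, x.2, hc ⟨x.1, h x.2⟩⟩
  have hF : ∀ i W h s (x : X) (hx : x ∈ W) (hi : x ∈ U i), F W h s ⟨x, hx⟩ =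
      ((P i).toFun (W ⊓ U i) inf_le_right (HolVB.res inf_le_left s)).1 ⟨x, hx, hi⟩ :=
    fun i W h s x hx hi => key _ _ _ _ x hx (hc ⟨x, h hx⟩) hi
  refine ⟨⟨fun W h s => ⟨F W h s, mem_sec_of_local _ fun x => ?_⟩, ?_, ?_, ?_, ?_⟩, ?_, ?_⟩
  · refine ⟨W ⊓ U (c ⟨x.1, h x.2⟩), inf_le_left, ⟨x.2, hc ⟨x.1, h x.2⟩⟩, ?_⟩
    convert ((P (c ⟨x.1, h x.2⟩)).toFun (W ⊓ U (c ⟨x.1, h x.2⟩)) inf_le_right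
      (HolVB.res inf_le_left s)).2 using 1
    funext y
    exact hF _ _ _ _ _ y.2.1 y.2.2
  · intro W h s t
    ext x
    change F W h _ x = F W h _ x + F W h _ x
    simp only [F, _root_.map_add, (P _).map_add]
    rfl
  · intro W h a s
    ext x
    change F W h _ x = a • F W h _ x
    simp only [F]
    have : HolVB.res (inf_le_left : W ⊓ U (c ⟨x.1, h x.2⟩) ≤ W) (a • s) =
      a • HolVB.res inf_le_left s := rfl
    rw [this, (P _).map_smul]
    rfl
  · intro W' W k h s
    ext x
    have hi := hc ⟨x.1, h (k x.2)⟩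
    change F W' _ _ ⟨x.1, x.2⟩ = F W h s ⟨x.1, k x.2⟩
    rw [hF _ _ _ _ _ x.2 hi, hF _ _ _ _ _ (k x.2) hi]
    exact key1 _ (W ⊓ U _) (W' ⊓ U _) (inf_le_inf_right _ k) inf_le_right
      (HolVB.res inf_le_left s) x.1 ⟨x.2, hi⟩
  · intro W h f g s
    ext x
    have hi := hc ⟨x.1, h x.2⟩
    have := congrArg (fun t : G.sec (W ⊓ U (c ⟨x.1, h x.2⟩)) => t.1 ⟨x.1, x.2, hi⟩)
      ((P (c ⟨x.1, h x.2⟩)).order_le_one (W ⊓ U (c ⟨x.1, h x.2⟩)) inf_le_right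
        (resFun inf_le_left f) (resFun inf_le_left g) (HolVB.res inf_le_left s))
    exact this
  · intro i
    refine ext' fun W h s => ?_
    ext x
    change F W _ s ⟨x.1, x.2⟩ = _
    rw [hF i _ _ _ _ x.2 (h x.2)]
    exact key1 i W (W ⊓ U i) inf_le_left h s x.1 ⟨x.2, h x.2⟩
  · intro Q hQ
    refine ext' fun W h s => ?_
    ext x
    have hi := hc ⟨x.1, h x.2⟩
    change _ = F W h s ⟨x.1, x.2⟩
    rw [hF _ _ _ _ _ x.2 hi, ← hQ]
    change _ = (Q.toFun (W ⊓ U _) _ (HolVB.res inf_le_left s)).1 ⟨x.1, x.2, hi⟩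
    rw [Q.map_res _ _ inf_le_left h]
    rfl

/-- The symbol of `P` at `x` is `S`, where an element of `Hom(E_x, G_x) ⊗ T_x X` is viewed as a
map sending a cotangent vector and an element of `E_x` to an element of `G_x`. -/
def HasSymbolAt (P : DiffOp E G U) (x : U)
    (S : (TangentSpace 𝓘(ℂ) x.1 →L[ℂ] ℂ) → E.fib x → G.fib x) : Prop :=
  ∀ (W : Opens X) (h : W ≤ U) (hx : x.1 ∈ W) (f : holFun W) (s : E.sec W),
    (P.toFun W h (f • s)).1 ⟨x, hx⟩ - f.1 ⟨x, hx⟩ • (P.toFun W h s).1 ⟨x, hx⟩ =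
      S (dAt f ⟨x, hx⟩) (s.1 ⟨x, hx⟩)

/-- An `𝒪`-linear morphism `E|_U → G|_U` of sheaves is a differential operator. -/
def ofLinear (L : ∀ W : Opens X, W ≤ U → E.sec W →ₗ[holFun W] G.sec W)
    (hL : ∀ W' W (k : W' ≤ W) (h : W ≤ U) s,
      L W' (k.trans h) (HolVB.res k s) = HolVB.res k (L W h s)) : DiffOp E G U where
  toFun W h s := L W h s
  map_add _ _ _ _ := _root_.map_add _ _ _
  map_smul _ _ _ _ := LinearMap.map_smul_of_tower _ _ _
  map_res := hL
  order_le_one W h f g s := by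
    simp only [_root_.map_smul]
    rw [smul_comm g f]
    abel

/-- Holomorphic sections of `Hom(E, G)`, as differential operators of order zero. -/
def ofHom : (E.Hom G).sec U →ₗ[holFun U] DiffOp E G U where
  toFun A := ofLinear (fun _ h => appHom (HolVB.res h A)) fun _ _ _ _ _ => rfl
  map_add' _ _ := rfl
  map_smul' _ _ := rfl

/-- For `A ∈ End(E)(U)` and `β ∈ V^*(U)`, the operator `A ⊗ β : s ↦ A(s) ⊗ β` of order zero
from `E` to `E ⊗ V^*`. -/
def endTens {V : HolVB.{u, w₂} X} (A : (E.Hom E).sec U) :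
    (V.Hom (trivial X)).sec U →ₗ[holFun U] DiffOp E (V.Hom E) U where
  toFun β := ofLinear (fun _ h => (tensRight (HolVB.res h β)).comp (appHom (HolVB.res h A)))
    fun _ _ _ _ _ => rfl
  map_add' β β' := ext' fun _ h s =>
    tens_add (appHom (HolVB.res h A) s) (HolVB.res h β) (HolVB.res h β')
  map_smul' f β := ext' fun _ h s =>
    tens_smul (resFun h f) (appHom (HolVB.res h A) s) (HolVB.res h β)

lemma HasSymbolAt.add {P Q : DiffOp E G U} {x : U}
    {S T : (TangentSpace 𝓘(ℂ) x.1 →L[ℂ] ℂ) → E.fib x → G.fib x}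
    (hP : P.HasSymbolAt x S) (hQ : Q.HasSymbolAt x T) :
    (P + Q).HasSymbolAt x fun α e => S α e + T α e := fun W h hx f s => by
  refine Eq.trans ?_ (congrArg₂ (· + ·) (hP W h hx f s) (hQ W h hx f s))
  change (P.toFun W h (f • s)).1 ⟨x, hx⟩ + (Q.toFun W h (f • s)).1 ⟨x, hx⟩ -
    f.1 ⟨x, hx⟩ • ((P.toFun W h s).1 ⟨x, hx⟩ + (Q.toFun W h s).1 ⟨x, hx⟩) = _
  rw [smul_add]
  exact add_sub_add_comm _ _ _ _

lemma HasSymbolAt.smul {P : DiffOp E G U} {x : U}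
    {S : (TangentSpace 𝓘(ℂ) x.1 →L[ℂ] ℂ) → E.fib x → G.fib x}
    (a : holFun U) (hP : P.HasSymbolAt x S) :
    (a • P).HasSymbolAt x fun α e => a.1 x • S α e := fun W h hx f s => by
  refine Eq.trans ?_ (congrArg (a.1 x • ·) (hP W h hx f s))
  dsimp only
  rw [smul_sub, smul_comm (a.1 x)]
  rfl

lemma hasSymbolAt_ofLinear (L : ∀ W : Opens X, W ≤ U → E.sec W →ₗ[holFun W] G.sec W) (hL)
    (x : U) : (ofLinear L hL).HasSymbolAt x fun _ _ => 0 := fun W h hx f s => by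
  change (L W h (f • s)).1 ⟨x, hx⟩ - f.1 ⟨x, hx⟩ • (L W h s).1 ⟨x, hx⟩ = 0
  rw [_root_.map_smul]
  exact sub_self _

lemma HasSymbolAt.zero (x : U) : (0 : DiffOp E G U).HasSymbolAt x fun _ _ => 0 :=
  fun W h hx f s => by
  change 0 - f.1 ⟨x, hx⟩ • (0 : G.fib x.1) = 0
  rw [smul_zero, sub_zero]

lemma HasSymbolAt.res {P : DiffOp E G U} {W : Opens X} (h : W ≤ U) {x : W}
    {S : (TangentSpace 𝓘(ℂ) x.1 →L[ℂ] ℂ) → E.fib x → G.fib x}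
    (hP : P.HasSymbolAt ⟨x.1, h x.2⟩ S) : (DiffOp.res h P).HasSymbolAt x S :=
  fun W' k hx f s => hP W' (k.trans h) hx f s

lemma hasSymbolAt_of_local {P : DiffOp E G U} {W : Opens X} (h : W ≤ U) {x : W}
    {S : (TangentSpace 𝓘(ℂ) x.1 →L[ℂ] ℂ) → E.fib x → G.fib x}
    (hP : (DiffOp.res h P).HasSymbolAt x S) : P.HasSymbolAt ⟨x.1, h x.2⟩ S :=
  fun W' k hx f s => by
  have e := hP (W' ⊓ W) inf_le_right ⟨hx, x.2⟩ (resFun inf_le_left f) (HolVB.res inf_le_left s)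
  have e1 := congrArg (fun t : G.sec (W' ⊓ W) => t.1 ⟨x.1, hx, x.2⟩)
    (P.map_res (W' ⊓ W) W' inf_le_left k s)
  have e2 := congrArg (fun t : G.sec (W' ⊓ W) => t.1 ⟨x.1, hx, x.2⟩)
    (P.map_res (W' ⊓ W) W' inf_le_left k (f • s))
  have e3 : dAt (resFun (inf_le_left : W' ⊓ W ≤ W') f) ⟨x.1, hx, x.2⟩ = dAt f ⟨x.1, hx⟩ :=
    dAt_res _ _ _ _
  rw [e3] at e
  refine Eq.trans (congrArg₂ (· - ·) e2.symm (congrArg (f.1 ⟨x.1, hx⟩ • ·) e1.symm)) e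

end DiffOp
end DiffOps

section LieAlgebroids
open HolVB
variable {X : Type u} [TopologicalSpace X] [ChartedSpace ℂ X] [IsManifold 𝓘(ℂ) ω X]

/-- A Lie algebroid structure on the holomorphic vector bundle `V`: a `ℂ`-Lie algebra structure on
the sheaf of holomorphic sections of `V` and an anchor `V → TX` satisfying the Leibniz rule. -/
structure LieAlgebroid (V : HolVB.{u, w} X) where
  anchor : (V.Hom (tangent X)).sec ⊤
  bracket : ∀ U : Opens X, V.sec U →ₗ[ℂ] V.sec U →ₗ[ℂ] V.sec U
  bracket_res : ∀ {W U : Opens X} (h : W ≤ U) (s t : V.sec U),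
    res h (bracket U s t) = bracket W (res h s) (res h t)
  skew : ∀ (U : Opens X) (s t : V.sec U), bracket U s t = -bracket U t s
  jacobi : ∀ (U : Opens X) (s t r : V.sec U),
    bracket U (bracket U s t) r + bracket U (bracket U t r) s + bracket U (bracket U r s) t = 0
  leibniz : ∀ (U : Opens X) (s t : V.sec U) (f : holFun U) (x : U),
    (bracket U s (f • t)).1 x = f.1 x • (bracket U s t).1 x +
      dAt f x (homAt anchor ⟨x.1, trivial⟩ (s.1 x)) • t.1 x

variable {V : HolVB.{u, u} X} (L : LieAlgebroid V) (E : HolVB.{u, u} X)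

namespace LieAlgebroid

/-- The anchor at the point `x`, as a linear map `V_x → T_x X`. -/
def anchorAt (x : X) : V.fib x →L[ℂ] TangentSpace 𝓘(ℂ) x := L.anchor.1 ⟨x, trivial⟩

/-- The value at `x` of `Id_E ⊗ φ`, a section of `End(E) ⊗ V^* ⊗ TX = Hom(E, E ⊗ V^*) ⊗ TX`:
it sends a cotangent vector `α` and `e ∈ E_x` to `e ⊗ φ^*(α)`. -/
def idTensAnchor (x : X) (α : TangentSpace 𝓘(ℂ) x →L[ℂ] ℂ) (e : E.fib x) :
    (V.Hom E).fib x :=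
  (ContinuousLinearMap.smulRight (α.comp (L.anchorAt x)) e : V.fib x →L[ℂ] E.fib x)

/-- `P ∈ Diff¹(E, E ⊗ V^*)(U)` has symbol `f · Id_E ⊗ φ`. -/
def HasSymbol {U : Opens X} (P : DiffOp E (V.Hom E) U) (f : holFun U) : Prop :=
  ∀ x : U, P.HasSymbolAt x fun α e => f.1 x • L.idTensAnchor E x.1 α e

/-- `Diff¹₁(E, E ⊗ V^*) = σ⁻¹((Id_E ⊗ φ)(𝒪_X))`. -/
def diffOne (U : Opens X) : Submodule (holFun U) (DiffOp E (V.Hom E) U) where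
  carrier := {P | ∃ f : holFun U, L.HasSymbol E P f}
  add_mem' := by
    rintro P Q ⟨f, hf⟩ ⟨g, hg⟩
    exact ⟨f + g, fun x W h hx a s =>
      (DiffOp.HasSymbolAt.add (hf x) (hg x) W h hx a s).trans (add_smul (f.1 x) (g.1 x) _).symm⟩
  zero_mem' := ⟨0, fun x W h hx a s =>
    (DiffOp.HasSymbolAt.zero x W h hx a s).trans (zero_smul ℂ _).symm⟩
  smul_mem' := by
    rintro g P ⟨f, hf⟩
    exact ⟨g * f, fun x W h hx a s =>
      (DiffOp.HasSymbolAt.smul g (hf x) W h hx a s).trans (mul_smul (g.1 x) (f.1 x) _).symm⟩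

variable {E} in
lemma diffOne_res {W U : Opens X} (h : W ≤ U) {P : DiffOp E (V.Hom E) U}
    (hP : P ∈ L.diffOne E U) : DiffOp.res h P ∈ L.diffOne E W := by
  obtain ⟨f, hf⟩ := hP
  exact ⟨resFun h f, fun x W' k hx a s => hf ⟨x.1, h x.2⟩ W' (k.trans h) hx a s⟩

/-- The sections over `U` of `Diff¹₁(E, E ⊗ V^*)`, as a module. -/
def DiffOne (U : Opens X) : Type u := L.diffOne E U

instance (U : Opens X) : AddCommGroup (L.DiffOne E U) :=
  inferInstanceAs (AddCommGroup (L.diffOne E U))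
instance (U : Opens X) : Module (holFun U) (L.DiffOne E U) :=
  inferInstanceAs (Module (holFun U) (L.diffOne E U))

/-- Restriction of sections of `Diff¹₁(E, E ⊗ V^*)`. -/
def diffOneRes {W U : Opens X} (h : W ≤ U) : L.DiffOne E U →ₛₗ[resFun h] L.DiffOne E W where
  toFun P := ⟨DiffOp.res h P.1, L.diffOne_res h P.2⟩
  map_add' _ _ := rfl
  map_smul' _ _ := rfl

/-- `A ⊗ β`, for `A ∈ End(E)(U)` and `β ∈ V^*(U)`, as a section of `Diff¹₁(E, E ⊗ V^*)`. -/
def endTens {U : Opens X} (A : (E.Hom E).sec U) :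
    (V.Hom (HolVB.trivial X)).sec U →ₗ[holFun U] L.DiffOne E U :=
  (DiffOp.endTens A).codRestrict _ fun _ => ⟨0, fun x W h hx a s =>
    (DiffOp.hasSymbolAt_ofLinear _ _ x W h hx a s).trans (zero_smul ℂ _).symm⟩

/-- The trace (contraction) `V^* ⊗ V = End(V) → 𝒪_X`. -/
def trace (V : HolVB.{u, u} X) (U : Opens X) :
    (V.Hom (HolVB.trivial X)).sec U ⊗[holFun U] V.sec U →ₗ[holFun U] holFun U :=
  TensorProduct.lift
    { toFun := pair
      map_add' := fun _ _ => LinearMap.ext fun _ => Subtype.ext (funext fun _ => rfl)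
      map_smul' := fun _ _ => LinearMap.ext fun _ => Subtype.ext (funext fun _ => rfl) }

/-- The map `ι(A ⊗ -) : V^* ⊗ V → Diff¹₁(E, E ⊗ V^*) ⊗ V`, `β ⊗ v ↦ (A ⊗ β) ⊗ v`. -/
def iota {U : Opens X} (A : (E.Hom E).sec U) :
    (V.Hom (HolVB.trivial X)).sec U ⊗[holFun U] V.sec U →ₗ[holFun U]
      L.DiffOne E U ⊗[holFun U] V.sec U :=
  TensorProduct.map (L.endTens E A) LinearMap.id

/-- `ι(End(E) ⊗ End⁰(V)) ⊆ Diff¹₁(E, E ⊗ V^*) ⊗ V` over `U`, where `End⁰(V) ⊆ V^* ⊗ V` is the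
kernel of the trace. -/
def traceless (U : Opens X) : Submodule (holFun U) (L.DiffOne E U ⊗[holFun U] V.sec U) :=
  Submodule.span _ {t | ∃ (A : (E.Hom E).sec U)
    (τ : (V.Hom (HolVB.trivial X)).sec U ⊗[holFun U] V.sec U),
      trace V U τ = 0 ∧ L.iota E A τ = t}

/-- Restriction of sections of the presheaf `Diff¹₁(E, E ⊗ V^*) ⊗ V`. -/
def tensorRes {W U : Opens X} (h : W ≤ U) :
    L.DiffOne E U ⊗[holFun U] V.sec U →ₛₗ[resFun h] L.DiffOne E W ⊗[holFun W] V.sec W :=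
  TensorProduct.map (L.diffOneRes E h) (res h)

lemma tensorRes_traceless {W U : Opens X} (h : W ≤ U) :
    L.traceless E U ≤ (L.traceless E W).comap (L.tensorRes E h) := by
  refine Submodule.span_le.2 ?_
  rintro _ ⟨A, τ, hτ, rfl⟩
  refine Submodule.subset_span ⟨res h A, TensorProduct.map (res h) (res h) τ, ?_, ?_⟩
  · have : trace V W (TensorProduct.map (res h) (res h) τ) = resFun h (trace V U τ) := by
      clear hτ
      induction τ with
      | zero => rw [LinearMap.map_zero, LinearMap.map_zero, LinearMap.map_zero, map_zero]
      | tmul β v => rfl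
      | add a b ha hb => rw [map_add, map_add, map_add, map_add, ha, hb]
    rw [this, hτ, map_zero]
  · clear hτ
    induction τ with
    | zero => rw [LinearMap.map_zero, LinearMap.map_zero, LinearMap.map_zero, LinearMap.map_zero]
    | tmul β v => rfl
    | add a b ha hb => rw [map_add, map_add, map_add, map_add, ha, hb]

/-- The presheaf `U ↦ (Diff¹₁(E, E ⊗ V^*)(U) ⊗ V(U)) / ι(End(E) ⊗ End⁰(V))(U)`. -/
def atiyahPresheaf : PresheafOfModules.{u} (holSheaf X).obj :=
  mkPresheaf (fun U => (L.DiffOne E U ⊗[holFun U] V.sec U) ⧸ L.traceless E U)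
    (fun h => Submodule.mapQ _ _ (L.tensorRes E h) (L.tensorRes_traceless E h))
    (by
      intro U s
      obtain ⟨s, rfl⟩ := Submodule.Quotient.mk_surjective _ s
      rw [Submodule.mapQ_apply]
      congr 1
      induction s with
      | zero => rw [LinearMap.map_zero]
      | tmul P v => rfl
      | add a b ha hb => rw [LinearMap.map_add, ha, hb])
    (by
      intro W' W U h k s
      obtain ⟨s, rfl⟩ := Submodule.Quotient.mk_surjective _ s
      simp only [Submodule.mapQ_apply]
      congr 1
      induction s with
      | zero => rw [LinearMap.map_zero, LinearMap.map_zero, LinearMap.map_zero]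
      | tmul P v => rfl
      | add a b ha hb => rw [LinearMap.map_add, LinearMap.map_add, LinearMap.map_add, ha, hb])

/-- The generalized Atiyah sheaf
`𝒜_E = (Diff¹₁(E, E ⊗ V^*) ⊗ V) / ι(End(E) ⊗ End⁰(V))`. -/
def atiyah : SheafOfModules.{u} (holSheaf X) :=
  (PresheafOfModules.sheafification (𝟙 (holSheaf X).obj)).obj (L.atiyahPresheaf E)

/-- The class in `𝒜_E` of `P ⊗ v`. -/
def cls {U : Opens X} (P : L.DiffOne E U) (v : V.sec U) : (L.atiyah E).val.obj (op U) :=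
  ((PresheafOfModules.sheafificationAdjunction (𝟙 (holSheaf X).obj)).unit.app
    (L.atiyahPresheaf E)).app (op U)
      (Submodule.Quotient.mk (P ⊗ₜ[holFun U] v) :
        (L.DiffOne E U ⊗[holFun U] V.sec U) ⧸ L.traceless E U)

end LieAlgebroid
end LieAlgebroids

section AtiyahBundles
open HolVB
variable {X : Type u} [TopologicalSpace X] [ChartedSpace ℂ X]

/-- Sections over `U` of a sheaf of `𝒪_X`-modules. -/
abbrev secs (M : SheafOfModules.{v} (holSheaf X)) (U : Opens X) : Type v := M.val.obj (op U)

/-- Restriction of sections of a sheaf of `𝒪_X`-modules. -/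
def secsRes (M : SheafOfModules.{v} (holSheaf X)) {W U : Opens X} (h : W ≤ U) (s : secs M U) :
    secs M W := M.val.map (homOfLE h).op s

/-- The map on sections over `U` of a morphism of sheaves of `𝒪_X`-modules. -/
def onSecs {M N : SheafOfModules.{v} (holSheaf X)} (g : M ⟶ N) {U : Opens X} (s : secs M U) :
    secs N U := g.val.app (op U) s

/-- A holomorphic section of `E`, as a section of the sheaf `E.sheaf`. -/
def HolVB.toSecs {E : HolVB.{u, w} X} {U : Opens X} (s : E.sec U) : secs E.sheaf U := s

/-- A morphism of sheaves of modules from compatible linear maps on sections. -/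
def mkHom {M N : SheafOfModules.{u} (holSheaf X)}
    (g : ∀ U : Opens X, secs M U →ₗ[(holSheaf X).obj.obj (op U)] secs N U)
    (hg : ∀ {W U : Opens X} (h : W ≤ U) (s : secs M U),
      g W (secsRes M h s) = secsRes N h (g U s)) : M ⟶ N where
  val :=
    { app := fun U => ModuleCat.ofHom (g U.unop)
      naturality := fun {U W} h => by
        ext s
        exact hg (leOfHom h.unop) s }

/-- `M` is locally free of rank `n`: locally there are `n` sections whose restrictions to every
smaller open set are a basis. -/
def IsLocallyFreeOfRank (M : SheafOfModules.{u} (holSheaf X)) (n : ℕ) : Prop :=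
  ∀ x : X, ∃ (U : Opens X) (_ : x ∈ U) (b : Fin n → secs M U), ∀ (W : Opens X) (h : W ≤ U),
    ∃ B : Module.Basis (Fin n) ((holSheaf X).obj.obj (op W)) (secs M W),
      ∀ i, B i = secsRes M h (b i)

section At
variable (E : HolVB.{u, u} X)

/-- The sections over `U` of `At(E) = σ₀⁻¹(Id_E ⊗ TX) ⊆ Diff¹(E, E)`: the operators of order one
whose symbol at each point `x` is `Id_{E_x} ⊗ ξ` for some tangent vector `ξ` at `x`. -/
def atSec (U : Opens X) : Submodule (holFun U) (DiffOp E E U) where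
  carrier := {P | ∀ x : U, ∃ ξ : TangentSpace 𝓘(ℂ) x.1, P.HasSymbolAt x fun α e => α ξ • e}
  add_mem' := by
    intro P Q hP hQ x
    obtain ⟨ξ, hξ⟩ := hP x
    obtain ⟨η, hη⟩ := hQ x
    refine ⟨ξ + η, fun W h hx a s => (DiffOp.HasSymbolAt.add hξ hη W h hx a s).trans ?_⟩
    dsimp only
    rw [map_add, add_smul]
  zero_mem' := fun x => ⟨0, fun W h hx a s =>
    (DiffOp.HasSymbolAt.zero x W h hx a s).trans (by dsimp only; rw [map_zero, zero_smul])⟩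
  smul_mem' := by
    intro f P hP x
    obtain ⟨ξ, hξ⟩ := hP x
    refine ⟨f.1 x • ξ, fun W h hx a s => (DiffOp.HasSymbolAt.smul f hξ W h hx a s).trans ?_⟩
    dsimp only
    rw [map_smul, smul_assoc]

variable {E} in
lemma atSec_res {W U : Opens X} (h : W ≤ U) {P : DiffOp E E U} (hP : P ∈ atSec E U) :
    DiffOp.res h P ∈ atSec E W := fun x => by
  obtain ⟨ξ, hξ⟩ := hP ⟨x.1, h x.2⟩
  exact ⟨ξ, DiffOp.HasSymbolAt.res h hξ⟩

/-- Restriction of sections of `At(E)`. -/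
def atRes {W U : Opens X} (h : W ≤ U) : atSec E U →ₛₗ[resFun h] atSec E W where
  toFun P := ⟨DiffOp.res h P.1, atSec_res h P.2⟩
  map_add' _ _ := rfl
  map_smul' _ _ := rfl

/-- The Atiyah sheaf `At(E)`. -/
def atSheaf : SheafOfModules.{u} (holSheaf X) :=
  mkSheaf.{u, u} (fun U => atSec E U) (fun h => atRes E h) (fun _ _ => rfl) (fun _ _ _ => rfl)
    (by
      intro ι U P hP
      obtain ⟨Q, hQ, hQ'⟩ := DiffOp.glue U (fun i => (P i).1)
        fun i j => congrArg Subtype.val (hP i j)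
      refine ⟨⟨Q, fun x => ?_⟩, fun i => Subtype.ext (hQ i), fun R hR =>
        Subtype.ext (hQ' R.1 fun i => congrArg Subtype.val (hR i))⟩
      obtain ⟨i, hi⟩ := Opens.mem_iSup.1 x.2
      obtain ⟨ξ, hξ⟩ := (P i).2 ⟨x.1, hi⟩
      rw [← hQ i] at hξ
      exact ⟨ξ, DiffOp.hasSymbolAt_of_local (le_iSup U i) hξ⟩)

/-- A section of the sheaf `At(E)` as a differential operator. -/
def atOp {E : HolVB.{u, u} X} {U : Opens X} (P : secs (atSheaf E) U) : DiffOp E E U :=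
  Subtype.val (p := fun P => P ∈ atSec E U) P

/-- The inclusion `End(E) → At(E)` as the operators of order zero. -/
def endToAt : (E.Hom E).sheaf ⟶ atSheaf E :=
  mkHom (M := (E.Hom E).sheaf) (N := atSheaf E)
    (fun U => (DiffOp.ofHom.codRestrict (atSec E U) fun A x => ⟨0, fun W h hx a s =>
      (DiffOp.hasSymbolAt_ofLinear _ _ x W h hx a s).trans (by dsimp only; rw [map_zero, zero_smul])⟩ :
      (E.Hom E).sec U →ₗ[holFun U] atSec E U))
    fun _ _ => rfl

end At

namespace LieAlgebroid
variable [IsManifold 𝓘(ℂ) ω X]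
variable {V : HolVB.{u, u} X} (L : LieAlgebroid V) (E : HolVB.{u, u} X)

/-- The anchor as a morphism of sheaves `V → TX`. -/
def anchorHom : V.sheaf ⟶ (tangent X).sheaf :=
  mkHom (M := V.sheaf) (N := (tangent X).sheaf)
    (fun U => (appHom (res le_top L.anchor) : V.sec U →ₗ[holFun U] (tangent X).sec U))
    fun _ _ => rfl

/-- A (holomorphic) Lie algebroid connection on `E`: a first order differential operator `D` from
`E` to `E ⊗ V^*` such that `D(f s) = f D(s) + s ⊗ φ^*(df)`. -/
structure Connection where
  op : DiffOp E (V.Hom E) ⊤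
  leibniz : ∀ (W : Opens X) (f : holFun W) (s : E.sec W) (x : W),
    (op.toFun W le_top (f • s)).1 x = f.1 x • (op.toFun W le_top s).1 x +
      L.idTensAnchor E x.1 (dAt f x) (s.1 x)

variable {L E} in
lemma Connection.hasSymbol (D : L.Connection E) (U : Opens X) :
    L.HasSymbol E (DiffOp.res (le_top : U ≤ ⊤) D.op) 1 := fun x W h hx f s => by
  refine Eq.trans ?_ (one_smul ℂ _).symm
  exact sub_eq_of_eq_add' (D.leibniz W f s ⟨x.1, hx⟩)

/-- The restriction to `U` of a connection, as a section of `Diff¹₁(E, E ⊗ V^*)`. -/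
def Connection.restrict {L : LieAlgebroid V} {E : HolVB.{u, u} X} (D : L.Connection E)
    (U : Opens X) : L.DiffOne E U :=
  ⟨DiffOp.res le_top D.op, 1, D.hasSymbol U⟩

variable {E} in
/-- The operator underlying a section of `Diff¹₁(E, E ⊗ V^*)`. -/
def DiffOne.toOp {U : Opens X} (P : L.DiffOne E U) : DiffOp E (V.Hom E) U :=
  Subtype.val (p := fun P => P ∈ L.diffOne E U) P

end LieAlgebroid

end AtiyahBundles

end RiemannSurface

end

-- Everything is read off from one isomorphism. The map [P ⊗ v] ↦ (σ̂(P) v, ⟨v, P⟩) identifies 𝒜_E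
-- with the fibre product V ×_{TX} At(E) (`fibSheaf`), whose sections are the pairs (v, Q) with Q :
-- E → E an operator of symbol Id_E ⊗ φ(v).
--
-- For the fibre product all claims are formal. The kernel of the projection to V consists of the
-- pairs (0, A) with A of order zero. That projection is locally surjective because a local frame of
-- E gives a flat connection, hence an operator with any prescribed symbol. The right-hand square is
-- the defining condition of the fibre product. A splitting v ↦ (v, Q_v) is an 𝒪-linear family of
-- operators with symbol φ(v), and such a family is contraction with a single operator D : E → E ⊗
-- V^* satisfying the Leibniz rule (`DiffOp.exists_contract_eq`, `exists_toFib_eq`).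
--
-- The map is well defined for two reasons. The function σ̂(P) is unique (`HasSymbol.unique`): E is
-- nonzero, and φ, being nonzero on a connected surface, vanishes on no nonempty open set by the
-- identity theorem. And ι(A ⊗ τ) goes to (0, tr(τ) A), so the traceless part dies
-- (`tensorToFib_iota`).
--
-- It is bijective over each open set with frames of E and of V (`quotToFib_bijective`). There a
-- flat connection D has σ̂(D) = 1, and every P is f D + ∑ A_j ⊗ b^j. Modulo the traceless part, (A
-- ⊗ β) ⊗ w depends only on β(w) A. So each class is [D ⊗ v] + [(A ⊗ b^i) ⊗ b_i] for one fixed index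
-- i, and its image determines v and A. A locally bijective morphism from a presheaf to a sheaf
-- becomes an isomorphism after sheafification.

universe w₃

noncomputable section

namespace RiemannSurface

/-! ### Local frames and sections of Hom bundles. -/

section Frames
open HolVB
variable {X : Type u} [TopologicalSpace X] [ChartedSpace ℂ X]

/-- A holomorphic frame of `V` over `U`, together with its dual frame. -/
structure Frame (V : HolVB.{u, w} X) (U : Opens X) where
  vec : Fin (Module.finrank ℂ V.F) → V.sec U
  cov : Fin (Module.finrank ℂ V.F) → (V.Hom (trivial X)).sec U
  dual : ∀ (x : U) i j, covAt (cov i) x ((vec j).1 x) = if i = j then 1 else 0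
  sum : ∀ (x : U) (w : V.fib x), ∑ i, covAt (cov i) x w • (vec i).1 x = w

/-- The open set over which the preferred trivialization at `x` is defined. -/
def trivOpens (V : HolVB.{u, w} X) (x : X) : Opens X :=
  ⟨(trivializationAt V.F V.fib x).baseSet, (trivializationAt V.F V.fib x).open_baseSet⟩

lemma mem_trivOpens (V : HolVB.{u, w} X) (x : X) : x ∈ trivOpens V x :=
  FiberBundle.mem_baseSet_trivializationAt' x

/-- The frame given by the preferred trivialization at a point. -/
def Frame.ofTriv (V : HolVB.{u, w} X) (x₀ : X) : Frame V (trivOpens V x₀) where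
  vec i := ⟨fun x => (trivializationAt V.F V.fib x₀).symm x.1 (Module.finBasis ℂ V.F i), by
    have h := (trivializationAt V.F V.fib x₀).contMDiffOn_localFrame_baseSet (I := 𝓘(ℂ))
      ω (Module.finBasis ℂ V.F) i
    have h' := h.comp_contMDiff (contMDiff_subtype_val (U := trivOpens V x₀)) fun x => x.2
    refine h'.congr fun x => ?_
    simp only [Function.comp]
    rw [Bundle.Trivialization.localFrame_apply_of_mem_baseSet _ _ x.2]
    simp only [Bundle.Trivialization.basisAt, Module.Basis.map_apply]
    exact congrArg (Bundle.TotalSpace.mk x.1)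
      (Bundle.Trivialization.linearEquivAt_symm_apply _ _ x.2 _).symm⟩
  cov i := ⟨fun x => (LinearMap.toContinuousLinearMap ((Module.finBasis ℂ V.F).coord i)).comp
      ((trivializationAt V.F V.fib x₀).continuousLinearMapAt ℂ x.1), by
    intro x
    refine (contMDiffAt_hom_bundle (F₁ := V.F) (E₁ := V.fib) (F₂ := ℂ)
      (E₂ := Bundle.Trivial X ℂ) _).2 ⟨contMDiff_subtype_val x, ?_⟩
    -- Read in the trivialization at `x`, the covector is the coordinate form composed with the
    -- coordinate change to the trivialization at `x₀`, and coordinate changes are holomorphic.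
    have h := contMDiffOn_coordChangeL (n := ω) (IB := 𝓘(ℂ)) (trivializationAt V.F V.fib x.1)
      (trivializationAt V.F V.fib x₀)
    have hU : (trivializationAt V.F V.fib x.1).baseSet ∩ (trivializationAt V.F V.fib x₀).baseSet
        ∈ nhds x.1 :=
      Filter.inter_mem ((trivOpens V x.1).2.mem_nhds (mem_trivOpens V x.1))
        ((trivOpens V x₀).2.mem_nhds x.2)
    have h1 := (h.contMDiffAt hU).comp x (contMDiff_subtype_val x)
    have h2 := ((ContinuousLinearMap.compL ℂ V.F V.F ℂ
      (LinearMap.toContinuousLinearMap ((Module.finBasis ℂ V.F).coord i))).contMDiff.contMDiffAt).comp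
        x h1
    refine h2.congr_of_eventuallyEq ?_
    filter_upwards [continuous_subtype_val.continuousAt.eventually hU] with y hy
    ext z
    have T : (trivializationAt ℂ (Bundle.Trivial X ℂ) x.1).continuousLinearMapAt ℂ y.1 =
      ContinuousLinearMap.id ℂ ℂ := Bundle.Trivial.continuousLinearMapAt_trivialization ℂ X ℂ y.1
    simp only [Function.comp, ContinuousLinearMap.inCoordinates, T]
    change (Module.finBasis ℂ V.F).coord i
      ((trivializationAt V.F V.fib x₀).continuousLinearMapAt ℂ y.1
        ((trivializationAt V.F V.fib x.1).symmL ℂ y.1 z)) =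
      (Module.finBasis ℂ V.F).coord i
        ((trivializationAt V.F V.fib x.1).coordChangeL ℂ (trivializationAt V.F V.fib x₀) y.1 z)
    rw [Bundle.Trivialization.coordChangeL_apply _ _ hy,
      Bundle.Trivialization.continuousLinearMapAt_apply_of_mem _ _ hy.2,
      Bundle.Trivialization.symmL_apply _ hy.1]⟩
  dual x i j := by
    change (Module.finBasis ℂ V.F).coord i
      ((trivializationAt V.F V.fib x₀).continuousLinearMapAt ℂ x.1
        ((trivializationAt V.F V.fib x₀).symm x.1 (Module.finBasis ℂ V.F j))) = _
    have := (trivializationAt V.F V.fib x₀).continuousLinearMapAt_symmL (R := ℂ) x.2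
      (Module.finBasis ℂ V.F j)
    rw [Bundle.Trivialization.symmL_apply _ x.2] at this
    rw [this]
    simp [Finsupp.single_apply, eq_comm]
  sum x w := by
    have := (trivializationAt V.F V.fib x₀).symmL_continuousLinearMapAt (R := ℂ) x.2 w
    conv_rhs => rw [← this, ← (Module.finBasis ℂ V.F).sum_repr
      ((trivializationAt V.F V.fib x₀).continuousLinearMapAt ℂ x.1 w)]
    rw [map_sum]
    refine Finset.sum_congr rfl fun i _ => ?_
    rw [map_smul, Bundle.Trivialization.symmL_apply _ x.2]
    rfl

variable {V : HolVB.{u, w₁} X} {G : HolVB.{u, w₂} X} {U : Opens X}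

/-- Restriction of frames. -/
def Frame.res (b : Frame V U) {W : Opens X} (h : W ≤ U) : Frame V W where
  vec i := HolVB.res h (b.vec i)
  cov i := HolVB.res h (b.cov i)
  dual x := b.dual ⟨x.1, h x.2⟩
  sum x := b.sum ⟨x.1, h x.2⟩

lemma exists_frame (V : HolVB.{u, w} X) {U : Opens X} (x : U) :
    ∃ W : Opens X, x.1 ∈ W ∧ W ≤ U ∧ Nonempty (Frame V W) :=
  ⟨trivOpens V x.1 ⊓ U, ⟨mem_trivOpens V x.1, x.2⟩, inf_le_right,
    ⟨(Frame.ofTriv V x.1).res inf_le_left⟩⟩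

lemma exists_frames (E : HolVB.{u, w₁} X) (V : HolVB.{u, w₂} X) {U : Opens X} (x : U) :
    ∃ W : Opens X, x.1 ∈ W ∧ W ≤ U ∧ Nonempty (Frame E W) ∧ Nonempty (Frame V W) := by
  obtain ⟨W, hx, hW, ⟨e⟩⟩ := exists_frame E x
  obtain ⟨W', hx', hW', ⟨b⟩⟩ := exists_frame V (⟨x.1, hx⟩ : W)
  exact ⟨W', hx', hW'.trans hW, ⟨e.res hW'⟩, ⟨b⟩⟩

lemma sum_apply {ι : Type*} (t : Finset ι) (s : ι → V.sec U) (x : U) :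
    (∑ i ∈ t, s i).1 x = ∑ i ∈ t, (s i).1 x := by
  classical
  induction t using Finset.induction_on with
  | empty => rfl
  | insert a t ha ih => rw [Finset.sum_insert ha, Finset.sum_insert ha, ← ih]; rfl

lemma Frame.sum_pair (b : Frame V U) (s : V.sec U) : ∑ i, pair (b.cov i) s • b.vec i = s := by
  ext x
  rw [sum_apply]
  exact b.sum x (s.1 x)

lemma Frame.pair_vec (b : Frame V U) (i j) :
    pair (b.cov i) (b.vec j) = if i = j then 1 else 0 := by
  refine Subtype.ext (funext fun x => (b.dual x i j).trans ?_)
  split_ifs <;> rfl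

/-- A frame is a basis of the module of sections. -/
def Frame.basis (b : Frame V U) : Module.Basis (Fin (Module.finrank ℂ V.F)) (holFun U) (V.sec U) :=
  Module.Basis.ofEquivFun
    { toFun := fun s i => pair (b.cov i) s
      invFun := fun f => ∑ i, f i • b.vec i
      map_add' := fun s t => funext fun i => map_add _ _ _
      map_smul' := fun f s => funext fun i => map_smul _ _ _
      left_inv := b.sum_pair
      right_inv := fun f => funext fun i => by
        simp [b.pair_vec] }

lemma Frame.basis_apply (b : Frame V U) (i) : b.basis i = b.vec i := by
  classical
  simp only [Frame.basis, Module.Basis.coe_ofEquivFun]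
  change ∑ j, (Pi.single i (1 : holFun U) : Fin _ → holFun U) j • b.vec j = _
  rw [Finset.sum_eq_single i]
  · simp
  · intro j _ hj
    simp [Pi.single_eq_of_ne hj]
  · simp

/-- Extend `w` with constant coefficients in a frame. This lets fibrewise identities be tested on
sections. -/
lemma exists_sec_eq (x : X) (w : V.fib x) :
    ∃ (W : Opens X) (hx : x ∈ W) (s : V.sec W), s.1 ⟨x, hx⟩ = w := by
  let b := Frame.ofTriv V x
  refine ⟨_, mem_trivOpens V x, ∑ i, (algebraMap ℂ (holFun (trivOpens V x))
    (covAt (b.cov i) ⟨x, mem_trivOpens V x⟩ w)) • b.vec i, ?_⟩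
  rw [sum_apply]
  exact b.sum ⟨x, mem_trivOpens V x⟩ w

/-- A vector of a fibre extends to a section near the point but perhaps not to all of `U`, so the
test has to run over every smaller open set. -/
lemma hom_ext {A B : (V.Hom G).sec U}
    (h : ∀ (W : Opens X) (k : W ≤ U) (s : V.sec W),
      appHom (HolVB.res k A) s = appHom (HolVB.res k B) s) : A = B := by
  refine sec_ext fun x => ContinuousLinearMap.ext fun w => ?_
  obtain ⟨W, hx, s, rfl⟩ := exists_sec_eq x.1 w
  have := congrArg (fun t : G.sec (W ⊓ U) => t.1 ⟨x.1, hx, x.2⟩)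
    (h (W ⊓ U) inf_le_right (HolVB.res inf_le_left s))
  exact this

lemma homAt_sum {ι : Type*} (t : Finset ι) (A : ι → (V.Hom G).sec U) (x : U) (w : V.fib x) :
    homAt (∑ i ∈ t, A i) x w = ∑ i ∈ t, homAt (A i) x w := by
  classical
  induction t using Finset.induction_on with
  | empty => rfl
  | insert a t ha ih => rw [Finset.sum_insert ha, Finset.sum_insert ha, ← ih]; rfl

/-- The section of `Hom(V, G)` with given values on a frame. -/
def Frame.toHom (b : Frame V U) (T : V.sec U →ₗ[holFun U] G.sec U) : (V.Hom G).sec U :=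
  ∑ i, tens (T (b.vec i)) (b.cov i)

lemma Frame.homAt_toHom (b : Frame V U) (T : V.sec U →ₗ[holFun U] G.sec U) (x : U) (w : V.fib x) :
    homAt (b.toHom T) x w = ∑ i, covAt (b.cov i) x w • (T (b.vec i)).1 x := by
  rw [Frame.toHom, homAt_sum]
  rfl

lemma Frame.appHom_toHom (b : Frame V U) (T : V.sec U →ₗ[holFun U] G.sec U) :
    appHom (b.toHom T) = T := by
  refine b.basis.ext fun j => ?_
  rw [b.basis_apply]
  ext x
  refine (b.homAt_toHom T x _).trans ?_
  simp [b.dual]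

/-- An 𝒪-linear morphism of sheaves comes from a section of the Hom bundle: over a frame it is given
by the images of the frame vectors, and these local sections glue because each is determined by its
action. -/
lemma exists_toHom (T : ∀ W : Opens X, W ≤ U → V.sec W →ₗ[holFun W] G.sec W)
    (hT : ∀ W' W (k : W' ≤ W) (h : W ≤ U) s,
      T W' (k.trans h) (HolVB.res k s) = HolVB.res k (T W h s)) :
    ∃ A : (V.Hom G).sec U, ∀ (W : Opens X) (h : W ≤ U), appHom (HolVB.res h A) = T W h := by
  choose B hxB hBU b using fun x : U => exists_frame V x
  replace b := fun x => (b x).some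
  let A := fun x : U => (b x).toHom (T (B x) (hBU x))
  have hA : ∀ x W (h : W ≤ B x) (hU : W ≤ U), appHom (HolVB.res h (A x)) = T W hU := by
    intro x W h hU
    refine ((b x).res h).basis.ext fun j => ?_
    rw [Frame.basis_apply]
    have e : appHom (HolVB.res h (A x)) (HolVB.res h ((b x).vec j)) =
      HolVB.res h (appHom (A x) ((b x).vec j)) := rfl
    refine e.trans ?_
    rw [(b x).appHom_toHom, ← hT]
    rfl
  have hsup : iSup B = U := le_antisymm (iSup_le hBU) fun x hx => Opens.mem_iSup.2 ⟨⟨x, hx⟩, hxB _⟩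
  obtain ⟨C, hC, -⟩ := HolVB.sec_glue (E := V.Hom G) B A fun x y => hom_ext fun W k s => by
    have e1 := hA x W (k.trans inf_le_left) ((k.trans inf_le_left).trans (hBU x))
    have e2 := hA y W (k.trans inf_le_right) ((k.trans inf_le_left).trans (hBU x))
    exact congrArg (· s) (e1.trans e2.symm)
  refine ⟨HolVB.res hsup.ge C, fun W h => LinearMap.ext fun s => ?_⟩
  ext y
  have hy := hxB ⟨y.1, h y.2⟩
  set x : U := ⟨y.1, h y.2⟩
  have e1 := congrArg (fun t => t (HolVB.res inf_le_left s))
    (hA x (W ⊓ B x) inf_le_right (inf_le_left.trans h))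
  have e2 := congrArg (fun t : G.sec (W ⊓ B x) => t.1 ⟨y.1, y.2, hy⟩)
    (e1.trans (hT (W ⊓ B x) W inf_le_left h s))
  refine Eq.trans ?_ e2
  rw [← hC x]
  rfl

end Frames

/-! ### Differentials of functions and holomorphic vector fields. -/

section Derivations
open HolVB
variable {X : Type u} [TopologicalSpace X] [ChartedSpace ℂ X]

/-- The extension by zero of a function on `U`. -/
def extFun {U : Opens X} (f : holFun U) : X → ℂ := Function.extend Subtype.val f.1 0

lemma extFun_apply {U : Opens X} (f : holFun U) (x : U) : extFun f x.1 = f.1 x :=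
  Subtype.val_injective.extend_apply f.1 0 x

lemma extFun_eventuallyEq {U : Opens X} (f : holFun U) (x : U) (g : X → ℂ)
    (hg : ∀ y : U, f.1 y = g y.1) : extFun f =ᶠ[nhds x.1] g := by
  filter_upwards [U.2.mem_nhds x.2] with y hy
  exact (extFun_apply f ⟨y, hy⟩).trans (hg ⟨y, hy⟩)

lemma contMDiffAt_extFun {U : Opens X} (f : holFun U) (x : U) :
    ContMDiffAt 𝓘(ℂ) 𝓘(ℂ) ω (extFun f) x.1 := by
  refine contMDiffAt_subtype_iff.1 (ContMDiffAt.congr_of_eventuallyEq ((f.2 : ContMDiff _ _ _ _) x)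
    (Filter.Eventually.of_forall fun y => extFun_apply f y))

lemma hasMFDerivAt_extFun {U : Opens X} (f : holFun U) (x : U) :
    HasMFDerivAt 𝓘(ℂ) 𝓘(ℂ) (extFun f) x.1 (dAt f x) :=
  ((contMDiffAt_extFun f x).mdifferentiableAt (by simp)).hasMFDerivAt

lemma dAt_eq {U : Opens X} (f : holFun U) (x : U) (g : X → ℂ) (hg : ∀ y : U, f.1 y = g y.1)
    {d : TangentSpace 𝓘(ℂ) x.1 →L[ℂ] ℂ} (hd : HasMFDerivAt 𝓘(ℂ) 𝓘(ℂ) g x.1 d) : dAt f x = d :=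
  hasMFDerivAt_unique (hasMFDerivAt_extFun f x)
    (hd.congr_of_eventuallyEq (extFun_eventuallyEq f x g hg))

lemma dAt_add {U : Opens X} (f g : holFun U) (x : U) : dAt (f + g) x = dAt f x + dAt g x :=
  dAt_eq _ _ (extFun f + extFun g)
    (fun y => (congrArg₂ (· + ·) (extFun_apply f y) (extFun_apply g y)).symm)
    ((hasMFDerivAt_extFun f x).add (hasMFDerivAt_extFun g x))

lemma dAt_mul {U : Opens X} (f g : holFun U) (x : U) :
    dAt (f * g) x = f.1 x • dAt g x + g.1 x • dAt f x := by
  have := (hasMFDerivAt_extFun f x).mul (hasMFDerivAt_extFun g x)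
  rw [extFun_apply, extFun_apply] at this
  exact dAt_eq _ _ (extFun f * extFun g)
    (fun y => (congrArg₂ (· * ·) (extFun_apply f y) (extFun_apply g y)).symm) this

lemma dAt_algebraMap {U : Opens X} (c : ℂ) (x : U) : dAt (algebraMap ℂ (holFun U) c) x = 0 :=
  dAt_eq _ _ (fun _ => c) (fun _ => rfl) (hasMFDerivAt_const c x.1)

lemma mem_sec_of_triv {V : HolVB.{u, w} X} (x₀ : X) {W : Opens X} (h : W ≤ trivOpens V x₀)
    (s : ∀ x : W, V.fib x) (hs : ContMDiff 𝓘(ℂ) 𝓘(ℂ, V.F) ω (fun y : W =>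
      (trivializationAt V.F V.fib x₀).continuousLinearMapAt ℂ y.1 (s y))) : s ∈ V.sec W := by
  intro x
  refine ((trivializationAt V.F V.fib x₀).contMDiffAt_iff
    ((Bundle.Trivialization.mem_source _).2 (h x.2))).2 ⟨contMDiff_subtype_val x,
      (hs x).congr_of_eventuallyEq (Filter.Eventually.of_forall fun y => ?_)⟩
  exact (Bundle.Trivialization.continuousLinearMapAt_apply_of_mem _ _ (h y.2) _).symm

variable [IsManifold 𝓘(ℂ) ω X]

/-- The derivative `ξ(f)` of a holomorphic function along a holomorphic vector field. -/
def lie {U : Opens X} (ξ : (tangent X).sec U) (f : holFun U) : holFun U :=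
  ⟨fun x => dAt f x (ξ.1 x), by
    intro x
    -- The differential is holomorphic in coordinates; no order is lost, since ω + 1 = ω. Applied to
    -- `ξ` it gives a holomorphic map to the tangent bundle of ℂ, whose fibre component is the
    -- wanted function.
    have h1 := ((contMDiffAt_extFun f x).mfderiv_const (m := ω) le_rfl).comp x
      (contMDiff_subtype_val x)
    have h2 : ContMDiffAt 𝓘(ℂ) 𝓘(ℂ) ω (fun y : U => extFun f y.1) x :=
      (contMDiffAt_extFun f x).comp x (contMDiff_subtype_val x)
    have h3 := ContMDiffAt.clm_apply_of_inCoordinates (F₁ := ℂ) (E₁ := TangentSpace 𝓘(ℂ) (M := X))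
      (F₂ := ℂ) (E₂ := TangentSpace 𝓘(ℂ) (M := ℂ)) (m₀ := x) (b₁ := fun y : U => y.1)
      (b₂ := fun y : U => extFun f y.1) (ϕ := fun y => dAt f y) h1 (ξ.2 x) h2
    exact (contMDiff_snd_tangentBundle_modelSpace ℂ 𝓘(ℂ)).contMDiffAt.comp x h3⟩

lemma lie_add {U : Opens X} (ξ : (tangent X).sec U) (f g : holFun U) :
    lie ξ (f + g) = lie ξ f + lie ξ g :=
  Subtype.ext (funext fun x => congrArg (· (ξ.1 x)) (dAt_add f g x))

lemma lie_mul {U : Opens X} (ξ : (tangent X).sec U) (f g : holFun U) :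
    lie ξ (f * g) = f * lie ξ g + g * lie ξ f :=
  Subtype.ext (funext fun x => congrArg (· (ξ.1 x)) (dAt_mul f g x))

lemma lie_smul {U : Opens X} (ξ : (tangent X).sec U) (c : ℂ) (f : holFun U) :
    lie ξ (c • f) = c • lie ξ f := by
  have h : lie ξ (algebraMap ℂ (holFun U) c) = 0 :=
    Subtype.ext (funext fun x => congrArg (· (ξ.1 x)) (dAt_algebraMap c x))
  rw [Algebra.smul_def, lie_mul, h, mul_zero, add_zero, ← Algebra.smul_def]

lemma add_lie {U : Opens X} (ξ η : (tangent X).sec U) (f : holFun U) :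
    lie (ξ + η) f = lie ξ f + lie η f :=
  Subtype.ext (funext fun x => (dAt f x).map_add _ _)

lemma zero_lie {U : Opens X} (f : holFun U) : lie (0 : (tangent X).sec U) f = 0 :=
  Subtype.ext (funext fun x => (dAt f x).map_zero)

lemma smul_lie {U : Opens X} (g : holFun U) (ξ : (tangent X).sec U) (f : holFun U) :
    lie (g • ξ) f = g * lie ξ f :=
  Subtype.ext (funext fun x => (dAt f x).map_smul _ _)

lemma lie_res {W U : Opens X} (h : W ≤ U) (ξ : (tangent X).sec U) (f : holFun U) :
    lie (HolVB.res h ξ) (resFun h f) = resFun h (lie ξ f) :=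
  Subtype.ext (funext fun x => congrArg (· (ξ.1 ⟨x.1, h x.2⟩)) (dAt_res h f x.1 x.2))

/-- The local coordinate at `x₀`. -/
def coord (x₀ : X) : holFun (trivOpens (tangent X) x₀) :=
  ⟨fun x => extChartAt 𝓘(ℂ) x₀ x.1, by
    have h := contMDiffOn_extChartAt (I := 𝓘(ℂ)) (n := ω) (x := x₀)
    exact h.comp_contMDiff (contMDiff_subtype_val (U := trivOpens (tangent X) x₀)) fun x => x.2⟩

/-- The trivialization of TX at `x₀` is the differential of the chart. Hence dz detects tangent
vectors and also measures whether a vector field is holomorphic. -/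
lemma dAt_coord (x₀ : X) (x : trivOpens (tangent X) x₀) :
    dAt (coord x₀) x =
      (trivializationAt ℂ (TangentSpace 𝓘(ℂ) (M := X)) x₀).continuousLinearMapAt ℂ x.1 := by
  rw [TangentBundle.continuousLinearMapAt_trivializationAt x.2]
  exact Filter.EventuallyEq.mfderiv_eq (extFun_eventuallyEq (coord x₀) x _ fun _ => rfl)

lemma eq_zero_of_dAt_coord {x₀ : X} {x : trivOpens (tangent X) x₀} {ξ : TangentSpace 𝓘(ℂ) x.1}
    (h : dAt (coord x₀) x ξ = 0) : ξ = 0 := by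
  rw [dAt_coord] at h
  rw [← (trivializationAt ℂ (TangentSpace 𝓘(ℂ) (M := X)) x₀).symmL_continuousLinearMapAt
    (R := ℂ) x.2 ξ, h, map_zero]

/-- It is enough to test on the local coordinate: ξ(z) is the expression of ξ in the trivialization
of TX. -/
lemma mem_sec_tangent {U : Opens X} (ξ : ∀ x : U, (tangent X).fib x)
    (h : ∀ (W : Opens X) (k : W ≤ U) (f : holFun W),
      (fun y : W => dAt f y (ξ ⟨y.1, k y.2⟩)) ∈ holFun W) : ξ ∈ (tangent X).sec U := by
  refine mem_sec_of_local _ fun x₀ => ⟨trivOpens (tangent X) x₀.1 ⊓ U, inf_le_right,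
    ⟨mem_trivOpens _ _, x₀.2⟩, fun x => ?_⟩
  have hW : ContMDiff 𝓘(ℂ) 𝓘(ℂ) ω _ := h (trivOpens (tangent X) x₀.1 ⊓ U) inf_le_right
    (resFun inf_le_left (coord x₀.1))
  refine mem_sec_of_triv (V := tangent X) x₀.1 inf_le_left _ (hW.congr fun y => ?_) x
  have e1 := dAt_res (inf_le_left : trivOpens (tangent X) x₀.1 ⊓ U ≤ _) (coord x₀.1) y.1 y.2
  rw [dAt_coord] at e1
  exact (congrArg (· (ξ ⟨y.1, y.2.2⟩)) e1).symm

end Derivations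

/-! ### The identity theorem. -/

section Identity
open HolVB
variable {X : Type u} [TopologicalSpace X] [ChartedSpace ℂ X] [IsManifold 𝓘(ℂ) ω X]

/-- `W` is a coordinate disc inside `U`, where the one-variable identity theorem applies. It is
chosen before `f`, so that one disc serves all components of a section at once. -/
lemma holFun_eq_zero_near {U : Opens X} (x : U) :
    ∃ W : Opens X, x.1 ∈ W ∧ ∃ h : W ≤ U, ∀ (f : holFun U) (O : Opens X),
      (∃ y, y ∈ O ∧ y ∈ W) → (∀ y : U, y.1 ∈ O → f.1 y = 0) → ∀ y : W, f.1 ⟨y.1, h y.2⟩ = 0 := by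
  let e := extChartAt 𝓘(ℂ) x.1
  have hopen : IsOpen (e.target ∩ e.symm ⁻¹' U) :=
    (continuousOn_extChartAt_symm (I := 𝓘(ℂ)) x.1).isOpen_inter_preimage
      (isOpen_extChartAt_target (I := 𝓘(ℂ)) x.1) U.2
  have hx : e x.1 ∈ e.target ∩ e.symm ⁻¹' U :=
    ⟨mem_extChartAt_target x.1, by simp [e]⟩
  obtain ⟨r, hr, hB⟩ := Metric.isOpen_iff.1 hopen _ hx
  refine ⟨⟨e.source ∩ e ⁻¹' Metric.ball (e x.1) r,
    (continuousOn_extChartAt (I := 𝓘(ℂ)) x.1).isOpen_inter_preimage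
      (isOpen_extChartAt_source (I := 𝓘(ℂ)) x.1) Metric.isOpen_ball⟩,
    ⟨mem_extChartAt_source x.1, Metric.mem_ball_self hr⟩, ?_, ?_⟩
  · rintro y ⟨hy, hy'⟩
    have := (hB hy').2
    rw [Set.mem_preimage, e.left_inv hy] at this
    exact this
  · rintro f O ⟨y, hyO, hy, hyB⟩ hO ⟨z, hz, hzB⟩
    have hd : DifferentiableOn ℂ (extFun f ∘ e.symm) (Metric.ball (e x.1) r) := by
      intro t ht
      have h1 := (contMDiffAt_extFun f ⟨e.symm t, (hB ht).2⟩).comp t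
        ((contMDiffOn_extChartAt_symm (I := 𝓘(ℂ)) (n := ω) x.1).contMDiffAt
          ((isOpen_extChartAt_target (I := 𝓘(ℂ)) x.1).mem_nhds (hB ht).1))
      exact ((h1.mdifferentiableAt (by simp)).differentiableAt).differentiableWithinAt
    have ha := hd.analyticOnNhd Metric.isOpen_ball
    have h0 : extFun f ∘ e.symm =ᶠ[nhds (e y)] 0 := by
      have hc : ContinuousAt e.symm (e y) := continuousAt_extChartAt_symm' (I := 𝓘(ℂ)) hy
      have hc' := hc.eventually (O.2.mem_nhds (by rw [e.left_inv hy]; exact hyO))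
      filter_upwards [hc', Metric.isOpen_ball.mem_nhds hyB] with t ht ht'
      exact (extFun_apply f ⟨e.symm t, (hB ht').2⟩).trans (hO _ ht)
    have h1 := ha.eqOn_zero_of_preconnected_of_eventuallyEq_zero
      (convex_ball (e x.1) r).isPreconnected hyB h0 hzB
    simp only [Function.comp, e.left_inv hz] at h1
    exact (extFun_apply f _).symm.trans h1

/-- The identity theorem for sections of holomorphic vector bundles. -/
lemma exists_ne_zero_of_ne_zero [ConnectedSpace X] {G : HolVB.{u, w} X} {s : G.sec ⊤} (hs : s ≠ 0)
    {O : Opens X} (hO : ∃ x, x ∈ O) : ∃ x ∈ O, s.1 ⟨x, trivial⟩ ≠ 0 := by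
  by_contra! H
  -- The interior of the zero set is open by construction. It is also closed: a disc around a point
  -- of the closure meets `Z`, so every frame component vanishes on the whole disc. Connectedness
  -- then forces `Z` to be everything.
  let Z : Set X := interior {x | s.1 ⟨x, trivial⟩ = 0}
  have hsub : ∀ y ∈ Z, s.1 ⟨y, _root_.trivial⟩ = 0 := fun y hy =>
    interior_subset (s := {x | s.1 ⟨x, _root_.trivial⟩ = 0}) hy
  have hZ : IsClosed Z := by
    refine isClosed_of_closure_subset fun x hx => ?_
    obtain ⟨U, hxU, -, ⟨b⟩⟩ := exists_frame G (⟨x, trivial⟩ : (⊤ : Opens X))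
    obtain ⟨W, hxW, h, hW⟩ := holFun_eq_zero_near (⟨x, hxU⟩ : U)
    refine mem_interior.2 ⟨W, fun y hy => ?_, W.2, hxW⟩
    obtain ⟨z, hz, hz'⟩ := mem_closure_iff.1 hx W W.2 hxW
    have key : ∀ i, (pair (b.cov i) (HolVB.res le_top s)).1 ⟨y, h hy⟩ = 0 := fun i =>
      hW _ ⟨Z, isOpen_interior⟩ ⟨z, hz', hz⟩ (fun t ht => by
        have ht : s.1 ⟨t.1, _root_.trivial⟩ = 0 := hsub _ ht
        change covAt (b.cov i) t (s.1 ⟨t.1, trivial⟩) = 0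
        rw [ht, map_zero]) ⟨y, hy⟩
    have := b.sum ⟨y, h hy⟩ (s.1 ⟨y, trivial⟩)
    refine this.symm.trans (Finset.sum_eq_zero fun i _ => ?_)
    exact (congrArg (· • _) (key i)).trans (zero_smul _ _)
  obtain ⟨x, hx⟩ := hO
  have hne : Z.Nonempty := ⟨x, mem_interior.2 ⟨O, fun y hy => H y hy, O.2, hx⟩⟩
  have huniv : Z = Set.univ := IsClopen.eq_univ ⟨hZ, isOpen_interior⟩ hne
  refine hs (sec_ext fun y => ?_)
  exact hsub y.1 (huniv ▸ Set.mem_univ y.1)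

end Identity

/-! ### Contractions, symbols and flat connections. -/

section Operators
open HolVB
variable {X : Type u} [TopologicalSpace X] [ChartedSpace ℂ X]
variable {E : HolVB.{u, w₁} X} {G : HolVB.{u, w₂} X} {V : HolVB.{u, w₃} X} {U : Opens X}

lemma pair_smul_complex (β : (V.Hom (trivial X)).sec U) (c : ℂ) (v : V.sec U) :
    pair β (c • v) = c • pair β v :=
  Subtype.ext (funext fun x => (covAt β x).map_smul _ _)

namespace DiffOp

/-- The contraction `⟨v, P⟩ : s ↦ ⟨v, P(s)⟩` of an operator `P : E → G ⊗ V^*` with a section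
`v` of `V`. -/
def contract : DiffOp E (V.Hom G) U →ₗ[holFun U] V.sec U →ₗ[holFun U] DiffOp E G U where
  toFun P :=
    { toFun := fun v =>
        { toFun := fun W h s => appHom (P.toFun W h s) (HolVB.res h v)
          map_add := fun W h s t => by rw [P.map_add]; rfl
          map_smul := fun W h c s => by rw [P.map_smul]; rfl
          map_res := fun W' W k h s => by rw [P.map_res W' W k h]; rfl
          order_le_one := fun W h f g s =>
            congrArg (fun A => appHom A (HolVB.res h v)) (P.order_le_one W h f g s) }
      map_add' := fun v w => ext' fun W h s => by
        change appHom (P.toFun W h s) (HolVB.res h (v + w)) = _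
        rw [_root_.map_add, _root_.map_add]; rfl
      map_smul' := fun f v => ext' fun W h s => by
        change appHom (P.toFun W h s) (HolVB.res h (f • v)) = _
        rw [LinearMap.map_smulₛₗ, LinearMap.map_smul]; rfl }
  map_add' _ _ := rfl
  map_smul' _ _ := rfl

lemma contract_ext {P Q : DiffOp E (V.Hom G) U}
    (h : ∀ (W : Opens X) (k : W ≤ U) (v : V.sec W),
      contract (DiffOp.res k P) v = contract (DiffOp.res k Q) v) : P = Q := by
  refine ext' fun W k s => hom_ext fun W' k' v => ?_
  have := congrArg (fun R : DiffOp E G W' => R.toFun W' le_rfl (HolVB.res k' s))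
    (h W' (k'.trans k) v)
  rw [← P.map_res, ← Q.map_res]
  exact this

/-- Tensor–Hom adjunction for differential operators: an operator E → G ⊗ V^* is the same as an
𝒪-linear family, indexed by V, of operators E → G. This is how connections are built, both from
frames and from splittings. -/
lemma exists_contract_eq (Q : ∀ W : Opens X, W ≤ U → V.sec W →ₗ[holFun W] DiffOp E G W)
    (hQ : ∀ (W' W : Opens X) (k : W' ≤ W) (h : W ≤ U) v,
      Q W' (k.trans h) (HolVB.res k v) = DiffOp.res k (Q W h v)) :
    ∃ D : DiffOp E (V.Hom G) U, ∀ (W : Opens X) (h : W ≤ U) v,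
      contract (DiffOp.res h D) v = Q W h v := by
  -- For fixed `s`, the assignment v ↦ Q(v)(s) is 𝒪-linear in v, so it is a section of Hom(V, G).
  -- That section is unique, and so the operator axioms pass from `Q` to `D`.
  have key : ∀ (W : Opens X) (h : W ≤ U) (s : E.sec W), ∃ A : (V.Hom G).sec W,
      ∀ (W' : Opens X) (k : W' ≤ W) v, appHom (HolVB.res k A) v =
        (Q W' (k.trans h) v).toFun W' le_rfl (HolVB.res k s) := by
    intro W h s
    obtain ⟨A, hA⟩ := exists_toHom (V := V) (G := G) (U := W)
      (fun W' k =>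
        { toFun := fun v => (Q W' (k.trans h) v).toFun W' le_rfl (HolVB.res k s)
          map_add' := fun v w => by rw [_root_.map_add]; rfl
          map_smul' := fun f v => by rw [LinearMap.map_smul]; rfl })
      (by
        intro W₁ W₂ k k' v
        change (Q W₁ _ (HolVB.res k v)).toFun W₁ le_rfl (HolVB.res _ s) =
          HolVB.res k ((Q W₂ _ v).toFun W₂ le_rfl (HolVB.res k' s))
        rw [hQ _ _ k (k'.trans h), ← DiffOp.map_res]
        rfl)
    exact ⟨A, fun W' k v => congrArg (· v) (hA W' k)⟩
  choose D hD using key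
  refine ⟨⟨D, ?_, ?_, ?_, ?_⟩, fun W h v => ext' fun W' k s => ?_⟩
  · intro W h s t
    refine hom_ext fun W' k v => ?_
    refine (hD _ _ _ _ _ _).trans ?_
    rw [_root_.map_add (HolVB.res k) s t, DiffOp.map_add, ← hD, ← hD]
    rfl
  · intro W h c s
    refine hom_ext fun W' k v => ?_
    refine (hD _ _ _ _ _ _).trans ?_
    have : HolVB.res k (c • s) = c • HolVB.res k s := rfl
    rw [this, DiffOp.map_smul, ← hD]
    rfl
  · intro W' W k h s
    refine hom_ext fun W'' k' v => ?_
    refine (hD _ _ _ _ _ _).trans (Eq.trans ?_ (hD W h s W'' (k'.trans k) v).symm)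
    rfl
  · intro W h f g s
    refine hom_ext fun W' k v => ?_
    have e := (Q W' (k.trans h) v).order_le_one W' le_rfl (resFun k f) (resFun k g)
      (HolVB.res k s)
    refine Eq.trans ?_ e
    have e1 := hD W h (f • g • s) W' k v
    have e2 := hD W h (g • s) W' k v
    have e3 := hD W h (f • s) W' k v
    have e4 := hD W h s W' k v
    have l1 : HolVB.res k (f • g • s) = resFun k f • resFun k g • HolVB.res k s := rfl
    have l2 : HolVB.res k (g • s) = resFun k g • HolVB.res k s := rfl
    have l3 : HolVB.res k (f • s) = resFun k f • HolVB.res k s := rfl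
    rw [l1] at e1
    rw [l2] at e2
    rw [l3] at e3
    rw [← e1, ← e2, ← e3, ← e4]
    rfl
  · have e := hD W' (k.trans h) s W' le_rfl (HolVB.res k v)
    refine Eq.trans (Eq.trans (by rfl) e) ?_
    rw [hQ _ _ k h]
    rfl

lemma ofHom_injective : Function.Injective (ofHom : (E.Hom G).sec U → DiffOp E G U) :=
  fun _ _ h => hom_ext fun W k s => congrArg (fun P : DiffOp E G U => P.toFun W k s) h

/-- An operator commuting with functions is a morphism of 𝒪-modules, so `exists_toHom` applies. It
identifies the kernel of the symbol map. -/
lemma exists_ofHom_eq {P : DiffOp E G U}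
    (hP : ∀ (W : Opens X) (h : W ≤ U) (f : holFun W) (s : E.sec W),
      P.toFun W h (f • s) = f • P.toFun W h s) : ∃ A, ofHom A = P := by
  obtain ⟨A, hA⟩ := exists_toHom (V := E) (G := G) (U := U)
    (fun W h =>
      { toFun := P.toFun W h
        map_add' := P.map_add W h
        map_smul' := hP W h })
    (fun W' W k h s => P.map_res W' W k h s)
  exact ⟨A, ext' fun W h s => congrArg (· s) (hA W h)⟩

variable [IsManifold 𝓘(ℂ) ω X]

/-- The symbol of `Q : E → E` is `Id_E ⊗ ξ`. -/
def IsSymbol (Q : DiffOp E E U) (ξ : (tangent X).sec U) : Prop :=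
  ∀ x : U, Q.HasSymbolAt x fun α e => α (ξ.1 x) • e

/-- Replaces the pointwise condition by a Leibniz rule between sections, on which symbols can be
computed by algebra. -/
lemma isSymbol_iff {Q : DiffOp E E U} {ξ : (tangent X).sec U} :
    Q.IsSymbol ξ ↔ ∀ (W : Opens X) (h : W ≤ U) (f : holFun W) (s : E.sec W),
      Q.toFun W h (f • s) = f • Q.toFun W h s + lie (HolVB.res h ξ) f • s :=
  ⟨fun H W h f s => sec_ext fun x => sub_eq_iff_eq_add'.1 (H ⟨x.1, h x.2⟩ W h x.2 f s),
    fun H x W h hx f s => sub_eq_iff_eq_add'.2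
      (congrArg (fun t : E.sec W => t.1 ⟨x.1, hx⟩) (H W h f s))⟩

lemma IsSymbol.add {P Q : DiffOp E E U} {ξ η : (tangent X).sec U} (hP : P.IsSymbol ξ)
    (hQ : Q.IsSymbol η) : (P + Q).IsSymbol (ξ + η) := by
  rw [isSymbol_iff] at *
  intro W h f s
  simp only [add_toFun, hP, hQ, _root_.map_add, add_lie]
  module

lemma IsSymbol.smul {P : DiffOp E E U} {ξ : (tangent X).sec U} (hP : P.IsSymbol ξ)
    (a : holFun U) : (a • P).IsSymbol (a • ξ) := by
  rw [isSymbol_iff] at *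
  intro W h f s
  simp only [smul_toFun, hP, LinearMap.map_smulₛₗ, smul_lie]
  module

lemma IsSymbol.res {P : DiffOp E E U} {ξ : (tangent X).sec U} (hP : P.IsSymbol ξ) {W : Opens X}
    (h : W ≤ U) : (DiffOp.res h P).IsSymbol (HolVB.res h ξ) :=
  fun x => HasSymbolAt.res h (hP ⟨x.1, h x.2⟩)

lemma isSymbol_zero : (0 : DiffOp E E U).IsSymbol 0 :=
  isSymbol_iff.2 fun W h f s => by
    rw [map_zero, zero_lie, zero_smul, add_zero]
    simp only [zero_toFun, smul_zero]

lemma IsSymbol.sub {P Q : DiffOp E E U} {ξ η : (tangent X).sec U} (hP : P.IsSymbol ξ)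
    (hQ : Q.IsSymbol η) : (P - Q).IsSymbol (ξ - η) := by
  have := hP.add (hQ.smul (-1))
  simpa only [neg_smul, one_smul, ← sub_eq_add_neg] using this

lemma isSymbol_ofHom (A : (E.Hom E).sec U) : (ofHom A).IsSymbol 0 :=
  isSymbol_iff.2 fun W h f s => by
    rw [map_zero, zero_lie, zero_smul, add_zero]
    exact LinearMap.map_smul (appHom (HolVB.res h A)) f s

lemma IsSymbol.exists_ofHom {P : DiffOp E E U} (hP : P.IsSymbol 0) : ∃ A, ofHom A = P :=
  exists_ofHom_eq fun W h f s => by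
    rw [isSymbol_iff.1 hP, map_zero, zero_lie, zero_smul, add_zero]

/-- Evaluate both symbols on dz and on a frame vector of E, which exists because E ≠ 0. Its
coefficient gives dz(ξ) = dz(η), and dz is injective on the tangent line. -/
lemma hasSymbolAt_unique (hE : 0 < Module.finrank ℂ E.F) {Q : DiffOp E E U} {x : U}
    {ξ η : TangentSpace 𝓘(ℂ) x.1} (hξ : Q.HasSymbolAt x fun α e => α ξ • e)
    (hη : Q.HasSymbolAt x fun α e => α η • e) : ξ = η := by
  obtain ⟨W, hxW, hWU, ⟨b⟩⟩ := exists_frame E x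
  let O := W ⊓ trivOpens (tangent X) x.1
  have hxO : x.1 ∈ O := ⟨hxW, mem_trivOpens _ _⟩
  let z : holFun O := resFun inf_le_right (coord x.1)
  let s := HolVB.res (inf_le_left : O ≤ W) (b.vec ⟨0, hE⟩)
  have e := (hξ O (inf_le_left.trans hWU) hxO z s).symm.trans
    (hη O (inf_le_left.trans hWU) hxO z s)
  have e1 := congrArg (fun t : E.fib x.1 => covAt (b.cov ⟨0, hE⟩) ⟨x.1, hxW⟩ t) e
  dsimp only at e1
  have hd : covAt (b.cov ⟨0, hE⟩) ⟨x.1, hxW⟩ (s.1 ⟨x.1, hxO⟩) = 1 :=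
    (b.dual ⟨x.1, hxW⟩ _ _).trans (if_pos rfl)
  rw [ContinuousLinearMap.map_smul, ContinuousLinearMap.map_smul, hd, smul_eq_mul, smul_eq_mul,
    mul_one, mul_one] at e1
  have e2 : dAt z ⟨x.1, hxO⟩ = dAt (coord x.1) ⟨x.1, mem_trivOpens _ _⟩ := dAt_res _ _ _ _
  rw [e2] at e1
  exact sub_eq_zero.1 (eq_zero_of_dAt_coord (x := ⟨x.1, mem_trivOpens _ _⟩)
    (((dAt (coord x.1) ⟨x.1, mem_trivOpens _ _⟩).map_sub _ _).trans (sub_eq_zero.2 e1)))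

lemma IsSymbol.unique (hE : 0 < Module.finrank ℂ E.F) {Q : DiffOp E E U}
    {ξ η : (tangent X).sec U} (hξ : Q.IsSymbol ξ) (hη : Q.IsSymbol η) : ξ = η :=
  sec_ext fun x => hasSymbolAt_unique hE (hξ x) (hη x)

/-- The tangent vectors, given point by point, vary holomorphically: ξ(f) is the coefficient along
the frame vector e₀ of Q(f e₀) − f Q(e₀). -/
lemma exists_isSymbol (hE : 0 < Module.finrank ℂ E.F) {Q : DiffOp E E U}
    (hQ : ∀ x : U, ∃ ξ : TangentSpace 𝓘(ℂ) x.1, Q.HasSymbolAt x fun α e => α ξ • e) :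
    ∃ ξ, Q.IsSymbol ξ := by
  choose ξ hξ using hQ
  refine ⟨⟨ξ, mem_sec_tangent _ fun W k f => ?_⟩, hξ⟩
  refine contMDiff_of_local _ fun x => ?_
  obtain ⟨O, hxO, hOW, ⟨b⟩⟩ := exists_frame E x
  refine ⟨O, hOW, hxO, ?_⟩
  let g : holFun O := pair (b.cov ⟨0, hE⟩)
    (Q.toFun O (hOW.trans k) (resFun hOW f • b.vec ⟨0, hE⟩) -
      resFun hOW f • Q.toFun O (hOW.trans k) (b.vec ⟨0, hE⟩))
  have hg : ContMDiff 𝓘(ℂ) 𝓘(ℂ) ω g.1 := g.2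
  refine hg.congr fun y => ?_
  have e := hξ ⟨y.1, k (hOW y.2)⟩ O (hOW.trans k) y.2 (resFun hOW f) (b.vec ⟨0, hE⟩)
  have e1 := congrArg (fun t : E.fib y.1 => covAt (b.cov ⟨0, hE⟩) y t) e
  refine Eq.trans ?_ e1.symm
  dsimp only
  rw [ContinuousLinearMap.map_smul]
  have hd : covAt (b.cov ⟨0, hE⟩) y ((b.vec ⟨0, hE⟩).1 y) = 1 :=
    (b.dual y _ _).trans (if_pos rfl)
  have e2 : dAt (resFun hOW f) ⟨y.1, y.2⟩ = dAt f ⟨y.1, hOW y.2⟩ := dAt_res _ _ _ _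
  rw [e2]
  exact ((congrArg _ hd).trans (mul_one _)).symm

end DiffOp

variable [IsManifold 𝓘(ℂ) ω X]

/-- The covariant derivative along vector fields for which a given frame is flat. -/
def Frame.flat (b : Frame E U) : (tangent X).sec U →ₗ[holFun U] DiffOp E E U where
  toFun ξ :=
    { toFun := fun W h s =>
        ∑ i, lie (HolVB.res h ξ) (pair (HolVB.res h (b.cov i)) s) • HolVB.res h (b.vec i)
      map_add := fun W h s t => by
        simp only [map_add, lie_add, add_smul, Finset.sum_add_distrib]
      map_smul := fun W h c s => by
        simp only [pair_smul_complex, lie_smul, smul_assoc, Finset.smul_sum]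
      map_res := fun W' W k h s => by
        rw [map_sum]
        refine Finset.sum_congr rfl fun i _ => ?_
        rw [LinearMap.map_smulₛₗ, ← lie_res]
        rfl
      order_le_one := fun W h f g s => by
        simp only [map_smul, smul_eq_mul, lie_mul, add_smul, Finset.sum_add_distrib,
          Finset.smul_sum, mul_smul, mul_add, smul_add]
        simp only [smul_smul, ← Finset.sum_add_distrib, ← Finset.sum_sub_distrib]
        refine Finset.sum_eq_zero fun i _ => ?_
        module }
  map_add' ξ η := DiffOp.ext' fun W h s => by
    simp only [DiffOp.add_toFun, map_add, add_lie, add_smul, Finset.sum_add_distrib]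
  map_smul' f ξ := DiffOp.ext' fun W h s => by
    simp only [DiffOp.smul_toFun, LinearMap.map_smulₛₗ, smul_lie, mul_smul, Finset.smul_sum,
      RingHom.id_apply]

/-- In coordinates ∇_ξ(∑ sᵢ eᵢ) = ∑ ξ(sᵢ) eᵢ, so the Leibniz rule is the product rule for ξ. Every
vector field is thus locally a symbol. -/
lemma Frame.flat_isSymbol (b : Frame E U) (ξ : (tangent X).sec U) : (b.flat ξ).IsSymbol ξ :=
  DiffOp.isSymbol_iff.2 fun W h f s => by
    change ∑ i, lie (HolVB.res h ξ) (pair (HolVB.res h (b.cov i)) (f • s)) • HolVB.res h (b.vec i) =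
      f • ∑ i, lie (HolVB.res h ξ) (pair (HolVB.res h (b.cov i)) s) • HolVB.res h (b.vec i) + _
    conv_rhs => rw [← (b.res h).sum_pair s]
    simp only [map_smul, smul_eq_mul, lie_mul, Finset.smul_sum, ← Finset.sum_add_distrib]
    refine Finset.sum_congr rfl fun i _ => ?_
    have := congrArg (fun t => pair ((b.res h).cov i) t) ((b.res h).sum_pair s)
    simp only [Frame.res] at this ⊢
    simp only [this]
    module

end Operators

/-! ### The coefficient σ̂ and the map to the fibre product. -/

section Local
open HolVB
variable {X : Type u} [TopologicalSpace X] [ChartedSpace ℂ X]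

lemma DiffOp.eq_of_frame {E : HolVB.{u, w₁} X} {G : HolVB.{u, w₂} X} {V : HolVB.{u, w₃} X}
    {U : Opens X} (b : Frame V U) {P Q : DiffOp E (V.Hom G) U}
    (h : ∀ i, contract P (b.vec i) = contract Q (b.vec i)) : P = Q := by
  refine contract_ext fun W k => LinearMap.congr_fun ?_
  refine (b.res k).basis.ext fun i => ?_
  rw [Frame.basis_apply]
  exact congrArg (DiffOp.res k) (h i)

variable [IsManifold 𝓘(ℂ) ω X] {E V : HolVB.{u, u} X} (L : LieAlgebroid V) {U : Opens X}

namespace LieAlgebroid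

/-- The anchor on sections over `U`. -/
def anch (U : Opens X) : V.sec U →ₗ[holFun U] (tangent X).sec U :=
  appHom (HolVB.res le_top L.anchor)

/-- Contracting f · Id_E ⊗ φ with v gives Id_E ⊗ φ(f v). With its converse below, this reduces
symbols on E ⊗ V^* to vector fields. -/
lemma HasSymbol.isSymbol_contract {L : LieAlgebroid V} {P : DiffOp E (V.Hom E) U} {f : holFun U}
    (hP : L.HasSymbol E P f) (v : V.sec U) :
    (DiffOp.contract P v).IsSymbol (L.anch U (f • v)) := fun x W h hx a s => by
  have e := congrArg (fun A : V.fib x.1 →L[ℂ] E.fib x.1 => A (v.1 x)) (hP x W h hx a s)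
  refine Eq.trans ?_ (e.trans ?_)
  · rfl
  · change f.1 x • (dAt a ⟨x.1, hx⟩ (L.anchorAt x.1 (v.1 x)) • s.1 ⟨x.1, hx⟩) =
      dAt a ⟨x.1, hx⟩ (L.anchorAt x.1 (f.1 x • v.1 x)) • s.1 ⟨x.1, hx⟩
    rw [map_smul, map_smul, smul_assoc]

lemma hasSymbol_of_isSymbol {P : DiffOp E (V.Hom E) U} {f : holFun U}
    (h : ∀ (W : Opens X) (k : W ≤ U) (v : V.sec W),
      (DiffOp.contract (DiffOp.res k P) v).IsSymbol (L.anch W (resFun k f • v))) :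
    L.HasSymbol E P f := fun x W k hx a s => by
  refine ContinuousLinearMap.ext fun w => ?_
  obtain ⟨O, hxO, v, hv⟩ := exists_sec_eq x.1 w
  have e := h (O ⊓ W) (inf_le_right.trans k) (HolVB.res inf_le_left v) ⟨x.1, hxO, hx⟩ (O ⊓ W)
    le_rfl ⟨hxO, hx⟩ (resFun inf_le_right a) (HolVB.res inf_le_right s)
  have e1 := congrArg (fun t : (V.Hom E).sec (O ⊓ W) => homAt t ⟨x.1, hxO, hx⟩ w)
    (P.map_res (O ⊓ W) W inf_le_right k (a • s))
  have e2 := congrArg (fun t : (V.Hom E).sec (O ⊓ W) => homAt t ⟨x.1, hxO, hx⟩ w)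
    (P.map_res (O ⊓ W) W inf_le_right k s)
  have e3 : dAt (resFun (inf_le_right : O ⊓ W ≤ W) a) ⟨x.1, hxO, hx⟩ = dAt a ⟨x.1, hx⟩ :=
    dAt_res _ _ _ _
  rw [e3] at e
  refine Eq.trans (congrArg₂ (· - ·) e1.symm (congrArg (a.1 ⟨x.1, hx⟩ • ·) e2.symm)) ?_
  subst hv
  refine Eq.trans e ?_
  change dAt a ⟨x.1, hx⟩ (L.anchorAt x.1 (f.1 x • v.1 ⟨x.1, hxO⟩)) • s.1 ⟨x.1, hx⟩ =
    f.1 x • (dAt a ⟨x.1, hx⟩ (L.anchorAt x.1 (v.1 ⟨x.1, hxO⟩)) • s.1 ⟨x.1, hx⟩)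
  rw [map_smul, map_smul, smul_assoc]

variable {L}

lemma HasSymbol.res {P : DiffOp E (V.Hom E) U} {f : holFun U} (hP : L.HasSymbol E P f)
    {W : Opens X} (h : W ≤ U) : L.HasSymbol E (DiffOp.res h P) (resFun h f) :=
  fun x W' k hx a s => hP ⟨x.1, h x.2⟩ W' (k.trans h) hx a s

/-- If f and g differ, they differ on a nonempty open set, and by the identity theorem φ(w) ≠ 0 for
some w over a point of it. Contracting P with a section through w gives f φ(w) = g φ(w), hence f = g
at that point, a contradiction. -/
lemma HasSymbol.unique [ConnectedSpace X] (hE : 0 < Module.finrank ℂ E.F) (hL : L.anchor ≠ 0)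
    {P : DiffOp E (V.Hom E) U} {f g : holFun U}
    (hf : L.HasSymbol E P f) (hg : L.HasSymbol E P g) : f = g := by
  by_contra hne
  have hcont : ∀ k : holFun U, Continuous k.1 := fun k => (k.2 : ContMDiff _ _ _ _).continuous
  let O : Opens X := ⟨Subtype.val '' {x : U | f.1 x ≠ g.1 x},
    U.2.isOpenMap_subtype_val _ (isOpen_ne_fun (hcont f) (hcont g))⟩
  have hO : ∃ x, x ∈ O := by
    by_contra! H
    exact hne (Subtype.ext (funext fun x => by_contra fun hx => H x.1 ⟨x, hx, rfl⟩))
  obtain ⟨_, ⟨x, hx, rfl⟩, hx0⟩ := exists_ne_zero_of_ne_zero hL hO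
  obtain ⟨w, hw⟩ : ∃ w, L.anchorAt x.1 w ≠ 0 := by
    by_contra! H
    exact hx0 (ContinuousLinearMap.ext H)
  obtain ⟨W, hxW, v, hv⟩ := exists_sec_eq x.1 w
  have e := ((hf.res (inf_le_right : W ⊓ U ≤ U)).isSymbol_contract
    (HolVB.res inf_le_left v)).unique hE
      ((hg.res (inf_le_right : W ⊓ U ≤ U)).isSymbol_contract (HolVB.res inf_le_left v))
  have e1 : L.anchorAt x.1 (f.1 x • v.1 ⟨x.1, hxW⟩) = L.anchorAt x.1 (g.1 x • v.1 ⟨x.1, hxW⟩) :=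
    congrArg (fun t : (tangent X).sec (W ⊓ U) => t.1 ⟨x.1, hxW, x.2⟩) e
  rw [map_smul, map_smul, hv] at e1
  exact hx (smul_left_injective ℂ hw e1)

/-- Supplies an index of a frame of V, needed to write a class as (A ⊗ b^i) ⊗ b_i. -/
lemma finrank_pos (hL : L.anchor ≠ 0) [Nonempty X] : 0 < Module.finrank ℂ V.F := by
  by_contra h0
  refine hL (sec_ext fun x => ContinuousLinearMap.ext fun w => ?_)
  obtain ⟨W, hxW, -, ⟨b⟩⟩ := exists_frame V x
  have hw : w = 0 := by
    rw [← b.sum ⟨x.1, hxW⟩ w]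
    refine Finset.sum_eq_zero fun i _ => (h0 (Nat.zero_lt_of_lt i.2)).elim
  rw [hw]
  exact (map_zero (L.anchorAt x.1))

variable (L) in
/-- The coefficient `σ̂(P)` of the symbol of `P`. -/
def sig [ConnectedSpace X] (hE : 0 < Module.finrank ℂ E.F) (hL : L.anchor ≠ 0) (U : Opens X) :
    L.DiffOne E U →ₗ[holFun U] holFun U where
  toFun P := P.2.choose
  map_add' P Q := HasSymbol.unique hE hL (P + Q).2.choose_spec fun x W h hx a s =>
    (DiffOp.HasSymbolAt.add (P.2.choose_spec x) (Q.2.choose_spec x) W h hx a s).trans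
      (add_smul (P.2.choose.1 x) (Q.2.choose.1 x) _).symm
  map_smul' g P := HasSymbol.unique hE hL (g • P).2.choose_spec fun x W h hx a s =>
    (DiffOp.HasSymbolAt.smul g (P.2.choose_spec x) W h hx a s).trans
      (mul_smul (g.1 x) (P.2.choose.1 x) _).symm

section
variable [ConnectedSpace X] (hE : 0 < Module.finrank ℂ E.F) (hL : L.anchor ≠ 0)

lemma hasSymbol_sig (P : L.DiffOne E U) : L.HasSymbol E P.toOp (L.sig hE hL U P) :=
  P.2.choose_spec

lemma sig_eq {P : L.DiffOne E U} {f : holFun U} (hf : L.HasSymbol E P.toOp f) :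
    L.sig hE hL U P = f := (hasSymbol_sig hE hL P).unique hE hL hf

lemma sig_res {W : Opens X} (h : W ≤ U) (P : L.DiffOne E U) :
    L.sig hE hL W (L.diffOneRes E h P) = resFun h (L.sig hE hL U P) :=
  sig_eq hE hL ((hasSymbol_sig hE hL P).res h)
end

lemma sig_endTens [ConnectedSpace X] (hE : 0 < Module.finrank ℂ E.F) (hL : L.anchor ≠ 0)
    (A : (E.Hom E).sec U) (β : (V.Hom (trivial X)).sec U) :
    L.sig hE hL U (L.endTens E A β) = 0 :=
  sig_eq hE hL fun x W h hx a s =>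
    (DiffOp.hasSymbolAt_ofLinear _ _ x W h hx a s).trans (zero_smul ℂ _).symm

lemma contract_endTens (A : (E.Hom E).sec U) (β : (V.Hom (trivial X)).sec U) (v : V.sec U) :
    DiffOp.contract (L.endTens E A β).toOp v = DiffOp.ofHom (pair β v • A) := rfl

variable (L E) in
/-- The sections over `U` of the fibre product `V ×_{TX} At(E)`. -/
def fibSec (U : Opens X) : Submodule (holFun U) (V.sec U × DiffOp E E U) where
  carrier := {p | p.2.IsSymbol (L.anch U p.1)}
  add_mem' := fun {p q} hp hq => by
    have := DiffOp.IsSymbol.add hp hq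
    rw [← map_add] at this
    exact this
  zero_mem' := by
    have := DiffOp.isSymbol_zero (E := E) (U := U)
    rw [← map_zero (L.anch U)] at this
    exact this
  smul_mem' := fun f p hp => by
    have := DiffOp.IsSymbol.smul hp f
    rw [← map_smul] at this
    exact this

instance : AddCommGroup (L.fibSec E U) := Submodule.addCommGroup _
instance : Module (holFun U) (L.fibSec E U) := Submodule.module _

variable (L E) in
/-- Restriction of sections of the fibre product. -/
def fibRes {W U : Opens X} (h : W ≤ U) : L.fibSec E U →ₛₗ[resFun h] L.fibSec E W where
  toFun p := ⟨(HolVB.res h p.1.1, DiffOp.res h p.1.2), DiffOp.IsSymbol.res p.2 h⟩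
  map_add' _ _ := rfl
  map_smul' _ _ := rfl

/-- Both components glue separately, and the symbol condition linking them is local. -/
lemma fib_glue {ι : Type*} (U : ι → Opens X) (s : ∀ i, L.fibSec E (U i))
    (hs : ∀ i j, L.fibRes E (inf_le_left : U i ⊓ U j ≤ U i) (s i) =
      L.fibRes E inf_le_right (s j)) :
    ∃! t : L.fibSec E (iSup U), ∀ i, L.fibRes E (le_iSup U i) t = s i := by
  obtain ⟨v, hv, hv'⟩ := HolVB.sec_glue U (fun i => (s i).1.1)
    fun i j => congrArg (fun t => t.1.1) (hs i j)
  obtain ⟨Q, hQ, hQ'⟩ := DiffOp.glue U (fun i => (s i).1.2)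
    fun i j => congrArg (fun t => t.1.2) (hs i j)
  refine ⟨⟨(v, Q), fun x => ?_⟩, fun i => Subtype.ext (Prod.ext (hv i) (hQ i)), fun t ht =>
    Subtype.ext (Prod.ext (hv' _ fun i => congrArg (fun t => t.1.1) (ht i))
      (hQ' _ fun i => congrArg (fun t => t.1.2) (ht i)))⟩
  obtain ⟨i, hi⟩ := Opens.mem_iSup.1 x.2
  have h : (s i).1.2.IsSymbol (L.anch (U i) (s i).1.1) := (s i).2
  have h' := h ⟨x.1, hi⟩
  rw [← hv i, ← hQ i] at h'
  exact DiffOp.hasSymbolAt_of_local (le_iSup U i) h'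

variable (L) in
/-- The inclusion of `End(E)` in the fibre product. -/
def endToFib (U : Opens X) : (E.Hom E).sec U →ₗ[holFun U] L.fibSec E U where
  toFun A := ⟨(0, DiffOp.ofHom A), by
    have := DiffOp.isSymbol_ofHom A
    rw [← map_zero (L.anch U)] at this
    exact this⟩
  map_add' A B := Subtype.ext (Prod.ext (add_zero _).symm (map_add _ _ _))
  map_smul' f A := Subtype.ext (Prod.ext (smul_zero _).symm (map_smul _ _ _))

variable [ConnectedSpace X] (hE : 0 < Module.finrank ℂ E.F) (hL : L.anchor ≠ 0)

/-- The map `P ⊗ v ↦ (σ̂(P) v, ⟨v, P⟩)`. -/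
def tensorToFib (U : Opens X) : L.DiffOne E U ⊗[holFun U] V.sec U →ₗ[holFun U] L.fibSec E U :=
  TensorProduct.lift (LinearMap.mk₂ (holFun U)
    (fun P v => ⟨(L.sig hE hL U P • v, DiffOp.contract P.toOp v),
      (hasSymbol_sig hE hL P).isSymbol_contract v⟩)
    (fun P Q v => Subtype.ext (Prod.ext (by
      change L.sig hE hL U (P + Q) • v = L.sig hE hL U P • v + L.sig hE hL U Q • v
      rw [map_add, add_smul]) rfl))
    (fun f P v => Subtype.ext (Prod.ext (by
      change L.sig hE hL U (f • P) • v = f • L.sig hE hL U P • v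
      rw [map_smul, smul_assoc]) rfl))
    (fun P v w => Subtype.ext (Prod.ext (smul_add _ _ _) (map_add _ _ _)))
    (fun f P v => Subtype.ext (Prod.ext (smul_comm _ _ _) (map_smul _ _ _))))

/-- On β ⊗ v the operator A ⊗ β has symbol zero and contracts to β(v) A. This is where the trace
enters: the traceless part maps to zero. -/
lemma tensorToFib_iota (A : (E.Hom E).sec U)
    (τ : (V.Hom (trivial X)).sec U ⊗[holFun U] V.sec U) :
    tensorToFib hE hL U (L.iota E A τ) = L.endToFib U (trace V U τ • A) := by
  induction τ with
  | zero => rw [map_zero, map_zero, map_zero, zero_smul, map_zero]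
  | tmul β v =>
    refine Subtype.ext (Prod.ext ?_ (contract_endTens A β v))
    exact (congrArg (· • v) (sig_endTens hE hL A β)).trans (zero_smul _ v)
  | add a b ha hb => rw [map_add, map_add, map_add, ha, hb, add_smul, map_add]

lemma traceless_le_ker : L.traceless E U ≤ LinearMap.ker (tensorToFib hE hL U) := by
  refine Submodule.span_le.2 ?_
  rintro _ ⟨A, τ, hτ, rfl⟩
  refine (tensorToFib_iota hE hL A τ).trans ?_
  rw [hτ, zero_smul, map_zero]

variable (L E) in
/-- The sections over `U` of the presheaf quotient defining `𝒜_E`. -/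
def QuotSec (U : Opens X) : Type u := (L.DiffOne E U ⊗[holFun U] V.sec U) ⧸ L.traceless E U

instance : AddCommGroup (L.QuotSec E U) :=
  Submodule.Quotient.addCommGroup (L.traceless E U)
instance : Module (holFun U) (L.QuotSec E U) :=
  Submodule.Quotient.module (L.traceless E U)

/-- The map `[P ⊗ v] ↦ (σ̂(P) v, ⟨v, P⟩)`. -/
def quotToFib (U : Opens X) : L.QuotSec E U →ₗ[holFun U] L.fibSec E U :=
  Submodule.liftQ (L.traceless E U) (tensorToFib hE hL U) (traceless_le_ker (U := U) hE hL)

lemma quotToFib_res {W U : Opens X} (h : W ≤ U)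
    (s : L.QuotSec E U) :
    quotToFib hE hL W (Submodule.mapQ _ _ (L.tensorRes E h) (L.tensorRes_traceless E h) s) =
      L.fibRes E h (quotToFib hE hL U s) := by
  obtain ⟨s, rfl⟩ := Submodule.Quotient.mk_surjective _ s
  change tensorToFib hE hL W (L.tensorRes E h s) = L.fibRes E h (tensorToFib hE hL U s)
  induction s with
  | zero => simp only [map_zero]
  | tmul P v =>
    refine Subtype.ext (Prod.ext ?_ rfl)
    change L.sig hE hL W (L.diffOneRes E h P) • HolVB.res h v =
      HolVB.res h (L.sig hE hL U P • v)
    rw [sig_res, LinearMap.map_smulₛₗ]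
  | add a b ha hb => simp only [map_add, ha, hb]

end LieAlgebroid
end Local

/-! ### Bijectivity over open sets with frames. -/

section LocalStructure
open HolVB
variable {X : Type u} [TopologicalSpace X] [ChartedSpace ℂ X] [IsManifold 𝓘(ℂ) ω X]
variable {E V : HolVB.{u, u} X} {L : LieAlgebroid V} {U : Opens X}

namespace LieAlgebroid

variable (L) in
-- The flat covariant derivative along φ(v) is 𝒪-linear in v, so it is the contraction of a single
-- operator, with coefficient σ̂ = 1.
lemma exists_flat_connection (e : Frame E U) : ∃ D : L.DiffOne E U,
    L.HasSymbol E D.toOp 1 ∧ ∀ v, DiffOp.contract D.toOp v = e.flat (L.anch U v) := by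
  obtain ⟨D, hD⟩ := DiffOp.exists_contract_eq (E := E) (G := E) (V := V) (U := U)
    (fun W h => (e.res h).flat.comp (L.anch W)) (fun W' W k h v => rfl)
  have hs : L.HasSymbol E D 1 := L.hasSymbol_of_isSymbol fun W k v => by
    rw [hD W k v, map_one, one_smul]
    exact (e.res k).flat_isSymbol _
  exact ⟨⟨D, 1, hs⟩, hs, fun v => hD U le_rfl v⟩

variable (L) in
/-- The isomorphism of `V ⊕ End(E)` with the fibre product given by a frame of `E`. -/
def frameToFib (e : Frame E U) : (V.sec U × (E.Hom E).sec U) ≃ₗ[holFun U] L.fibSec E U :=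
  LinearEquiv.ofBijective
    ((LinearMap.codRestrict (L.fibSec E U)
      (LinearMap.prod LinearMap.id (e.flat.comp (L.anch U))) fun v => e.flat_isSymbol _).coprod
        (L.endToFib U)) <| by
    have key : ∀ v A, (((LinearMap.codRestrict (L.fibSec E U)
      (LinearMap.prod LinearMap.id (e.flat.comp (L.anch U))) fun v => e.flat_isSymbol _).coprod
        (L.endToFib U)) (v, A)).1 = (v, e.flat (L.anch U v) + DiffOp.ofHom A) := fun v A =>
      Prod.ext (add_zero v) rfl
    refine ⟨(injective_iff_map_eq_zero _).2 ?_, ?_⟩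
    · rintro ⟨v, A⟩ h
      have h' := (key v A).symm.trans (congrArg Subtype.val h)
      obtain rfl : v = 0 := congrArg Prod.fst h'
      have h2 : e.flat (L.anch U 0) + DiffOp.ofHom A = 0 := congrArg Prod.snd h'
      rw [map_zero, map_zero, zero_add] at h2
      have : A = 0 := DiffOp.ofHom_injective (h2.trans (map_zero _).symm)
      rw [this]
      rfl
    · rintro ⟨⟨v, Q⟩, hQ⟩
      have hQ' : Q.IsSymbol (L.anch U v) := hQ
      -- `Q` and the flat derivative along φ(v) have the same symbol, so they differ by an operator
      -- of order zero.
      have := hQ'.sub (e.flat_isSymbol (L.anch U v))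
      rw [sub_self] at this
      obtain ⟨A, hA⟩ := this.exists_ofHom
      refine ⟨(v, A), Subtype.ext ((key v A).trans (Prod.ext rfl ?_))⟩
      dsimp only
      rw [hA]
      abel

lemma frameToFib_apply (e : Frame E U) (v : V.sec U) (A : (E.Hom E).sec U) :
    (L.frameToFib e (v, A)).1 = (v, e.flat (L.anch U v) + DiffOp.ofHom A) :=
  Prod.ext (add_zero v) rfl

lemma frameToFib_res (e : Frame E U) {W : Opens X} (h : W ≤ U) (v : V.sec U)
    (A : (E.Hom E).sec U) : L.frameToFib (e.res h) (HolVB.res h v, HolVB.res h A) =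
      L.fibRes E h (L.frameToFib e (v, A)) := rfl

variable (L) in
/-- The class of `P ⊗ v` modulo `ι(End(E) ⊗ End⁰(V))`. -/
def quotCls (P : L.DiffOne E U) (v : V.sec U) : L.QuotSec E U :=
  (L.traceless E U).mkQ (P ⊗ₜ v)

lemma quotCls_add (P : L.DiffOne E U) (v w : V.sec U) :
    L.quotCls P (v + w) = L.quotCls P v + L.quotCls P w :=
  (congrArg _ (TensorProduct.tmul_add _ _ _)).trans (map_add (L.traceless E U).mkQ _ _)

lemma add_quotCls (P Q : L.DiffOne E U) (v : V.sec U) :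
    L.quotCls (P + Q) v = L.quotCls P v + L.quotCls Q v :=
  (congrArg _ (TensorProduct.add_tmul _ _ _)).trans (map_add (L.traceless E U).mkQ _ _)

lemma quotCls_smul (f : holFun U) (P : L.DiffOne E U) (v : V.sec U) :
    L.quotCls P (f • v) = f • L.quotCls P v :=
  (congrArg _ (TensorProduct.tmul_smul _ _ _)).trans (map_smul (L.traceless E U).mkQ _ _)

lemma smul_quotCls (f : holFun U) (P : L.DiffOne E U) (v : V.sec U) :
    L.quotCls (f • P) v = f • L.quotCls P v :=
  (congrArg _ (TensorProduct.smul_tmul' _ _ _).symm).trans (map_smul (L.traceless E U).mkQ _ _)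

lemma zero_quotCls (v : V.sec U) : L.quotCls (0 : L.DiffOne E U) v = 0 :=
  (congrArg _ (TensorProduct.zero_tmul _ _)).trans (map_zero (L.traceless E U).mkQ)

lemma quotCls_zero (P : L.DiffOne E U) : L.quotCls P (0 : V.sec U) = 0 :=
  (congrArg _ (TensorProduct.tmul_zero _ _)).trans (map_zero (L.traceless E U).mkQ)

lemma sum_quotCls {ι : Type*} (t : Finset ι) (P : ι → L.DiffOne E U) (v : V.sec U) :
    L.quotCls (∑ i ∈ t, P i) v = ∑ i ∈ t, L.quotCls (P i) v := by
  classical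
  induction t using Finset.induction_on with
  | empty => exact zero_quotCls v
  | insert a t ha ih => rw [Finset.sum_insert ha, Finset.sum_insert ha, ← ih, add_quotCls]

/-- The tensor β ⊗ w − b^i ⊗ β(w) b_i is traceless because b^i(b_i) = 1. So every class coming from
order zero can be moved to the index i. -/
lemma quotCls_endTens (b : Frame V U) (i) (A : (E.Hom E).sec U)
    (β : (V.Hom (trivial X)).sec U) (w : V.sec U) :
    L.quotCls (L.endTens E A β) w =
      L.quotCls (L.endTens E A (b.cov i)) (pair β w • b.vec i) := by
  refine (Submodule.Quotient.eq _).2 (Submodule.subset_span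
    ⟨A, β ⊗ₜ w - b.cov i ⊗ₜ (pair β w • b.vec i), ?_, ?_⟩)
  · have h1 : trace V U (β ⊗ₜ w) = pair β w := rfl
    have h2 : trace V U (b.cov i ⊗ₜ (pair β w • b.vec i)) =
      pair (b.cov i) (pair β w • b.vec i) := rfl
    rw [map_sub, h1, h2, map_smul, b.pair_vec, if_pos rfl, smul_eq_mul, mul_one, sub_self]
  · rw [map_sub]
    rfl

lemma endTens_add (A B : (E.Hom E).sec U) (β : (V.Hom (trivial X)).sec U) :
    L.endTens E (A + B) β = L.endTens E A β + L.endTens E B β :=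
  Subtype.ext (DiffOp.ext' fun _ h s => map_add (tensRight (HolVB.res h β))
    (appHom (HolVB.res h A) s) (appHom (HolVB.res h B) s))

lemma endTens_smul (f : holFun U) (A : (E.Hom E).sec U) (β : (V.Hom (trivial X)).sec U) :
    L.endTens E (f • A) β = f • L.endTens E A β :=
  Subtype.ext (DiffOp.ext' fun _ h s => map_smul (tensRight (HolVB.res h β)) (resFun h f)
    (appHom (HolVB.res h A) s))

/-- A section of `Diff¹₁` in terms of a connection and a frame of `V`. -/
lemma DiffOne.eq_add_sum (b : Frame V U) {D P : L.DiffOne E U} {f : holFun U}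
    (hD : L.HasSymbol E D.toOp 1) (hP : L.HasSymbol E P.toOp f) :
    ∃ A : Fin (Module.finrank ℂ V.F) → (E.Hom E).sec U,
      P = f • D + ∑ i, L.endTens E (A i) (b.cov i) := by
  -- P − f D has symbol zero, so its contraction with each frame vector is an endomorphism; these
  -- are the coefficients along the dual frame.
  have key : ∀ i, ∃ A, DiffOp.ofHom A = DiffOp.contract (P - f • D).toOp (b.vec i) := fun i => by
    refine DiffOp.IsSymbol.exists_ofHom ?_
    have h1 := hP.isSymbol_contract (b.vec i)
    have h2 := (hD.isSymbol_contract (b.vec i)).smul f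
    rw [one_smul, ← map_smul (L.anch U)] at h2
    have h3 := h1.sub h2
    rw [sub_self] at h3
    have : DiffOp.contract (P - f • D).toOp (b.vec i) =
      DiffOp.contract P.toOp (b.vec i) - f • DiffOp.contract D.toOp (b.vec i) := by
      have e : (P - f • D).toOp = P.toOp - f • D.toOp := rfl
      rw [e, map_sub, map_smul]
      rfl
    rw [this]
    exact h3
  choose A hA using key
  refine ⟨A, eq_add_of_sub_eq' (Subtype.ext (DiffOp.eq_of_frame b fun i => ?_))⟩
  refine (hA i).symm.trans ?_
  have e : (∑ j, L.endTens E (A j) (b.cov j)).1 = ∑ j, (L.endTens E (A j) (b.cov j)).1 :=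
    map_sum (L.diffOne E U).subtype _ _
  rw [e, map_sum, LinearMap.sum_apply]
  have e2 : ∀ j, DiffOp.contract (L.endTens E (A j) (b.cov j)).1 (b.vec i) =
    pair (b.cov j) (b.vec i) • DiffOp.ofHom (A j) := fun j =>
      (contract_endTens (A j) (b.cov j) (b.vec i)).trans (map_smul _ _ _)
  simp only [e2, b.pair_vec, ite_smul, one_smul, zero_smul, Finset.sum_ite_eq', Finset.mem_univ,
    if_true]

/-- Normal form of a class: a connection part and one endomorphism. It bounds the quotient from
above, which gives injectivity of the map to the fibre product. -/
lemma exists_quotCls_eq (b : Frame V U) (i) {D : L.DiffOne E U} (hD : L.HasSymbol E D.toOp 1)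
    (t : L.QuotSec E U) : ∃ (v : V.sec U) (A : (E.Hom E).sec U),
      t = L.quotCls D v + L.quotCls (L.endTens E A (b.cov i)) (b.vec i) := by
  let S : (E.Hom E).sec U →ₗ[holFun U] L.QuotSec E U :=
    { toFun := fun A => L.quotCls (L.endTens E A (b.cov i)) (b.vec i)
      map_add' := fun A B => by rw [endTens_add, add_quotCls]
      map_smul' := fun f A => by rw [endTens_smul, smul_quotCls]; rfl }
  suffices h : ∃ v A, t = L.quotCls D v + S A from h
  obtain ⟨t, rfl⟩ := Submodule.Quotient.mk_surjective _ t
  induction t with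
  | zero => exact ⟨0, 0, by rw [quotCls_zero, map_zero, add_zero]; rfl⟩
  | tmul P w =>
    obtain ⟨f, hf⟩ := P.2
    obtain ⟨A, rfl⟩ := DiffOne.eq_add_sum b hD hf
    -- For P = f D + ∑ A_j ⊗ b^j, the factor f moves onto w, and (A_j ⊗ b^j) ⊗ w becomes b^j(w) A_j
    -- at the index i.
    refine ⟨f • w, ∑ j, pair (b.cov j) w • A j, ?_⟩
    change L.quotCls (f • D + ∑ j, L.endTens E (A j) (b.cov j)) w = _
    rw [add_quotCls, sum_quotCls, smul_quotCls, ← quotCls_smul, map_sum]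
    refine congrArg (_ + ·) (Finset.sum_congr rfl fun j _ => ?_)
    rw [quotCls_endTens b i, quotCls_smul, map_smul]
    rfl
  | add a c ha hc =>
    obtain ⟨v, A, h⟩ := ha
    obtain ⟨v', A', h'⟩ := hc
    refine ⟨v + v', A + A', ?_⟩
    rw [quotCls_add, map_add, add_add_add_comm, ← h, ← h']
    rfl

section
variable [ConnectedSpace X] (hE : 0 < Module.finrank ℂ E.F) (hL : L.anchor ≠ 0)

lemma quotToFib_quotCls (P : L.DiffOne E U) (v : V.sec U) :
    (quotToFib hE hL U (L.quotCls P v)).1 =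
      (L.sig hE hL U P • v, DiffOp.contract P.toOp v) := rfl

/-- Over an open set on which `E` and `V` have frames, the presheaf quotient is the fibre
product. -/
lemma quotToFib_bijective (e : Frame E U) (b : Frame V U) :
    Function.Bijective (quotToFib hE hL (L := L) U) := by
  obtain ⟨D, hD, hDv⟩ := L.exists_flat_connection e
  let i : Fin (Module.finrank ℂ V.F) := ⟨0, finrank_pos hL⟩
  -- A class in normal form goes to the pair with coordinates (v, A) under `frameToFib`, which is an
  -- isomorphism; both halves of bijectivity follow.
  have key : ∀ v A, quotToFib hE hL U (L.quotCls D v +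
      L.quotCls (L.endTens E A (b.cov i)) (b.vec i)) = L.frameToFib e (v, A) := fun v A => by
    refine Subtype.ext ?_
    rw [map_add, Submodule.coe_add, quotToFib_quotCls, quotToFib_quotCls, frameToFib_apply,
      sig_eq hE hL hD, sig_endTens, contract_endTens, b.pair_vec, hDv, if_pos rfl, one_smul,
      one_smul, zero_smul, Prod.mk_add_mk, add_zero]
  constructor
  · refine (injective_iff_map_eq_zero _).2 fun t ht => ?_
    obtain ⟨v, A, rfl⟩ := exists_quotCls_eq b i hD t
    rw [key] at ht
    have h0 := (L.frameToFib e).map_eq_zero_iff.1 ht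
    obtain rfl : v = 0 := congrArg Prod.fst h0
    obtain rfl : A = 0 := congrArg Prod.snd h0
    have hz : L.endTens E (0 : (E.Hom E).sec U) (b.cov i) = 0 := by
      have := endTens_smul (L := L) 0 (0 : (E.Hom E).sec U) (b.cov i)
      rwa [zero_smul, zero_smul] at this
    rw [hz, zero_quotCls, quotCls_zero, add_zero]
  · intro p
    obtain ⟨⟨v, A⟩, rfl⟩ := (L.frameToFib e).surjective p
    exact ⟨_, key v A⟩
end

end LieAlgebroid
end LocalStructure

/-! ### From local bijectivity to an isomorphism. -/

section Sheafification
open HolVB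
variable {X : Type u} [TopologicalSpace X] [ChartedSpace ℂ X]

/-- A locally bijective morphism from a presheaf to a sheaf induces an isomorphism from the
sheafification. -/
lemma isIso_of_locallyBijective {P : PresheafOfModules.{u} (holSheaf X).obj}
    {F : SheafOfModules.{u} (holSheaf X)}
    (ψ : P ⟶ (PresheafOfModules.restrictScalars (𝟙 (holSheaf X).obj)).obj
      ((SheafOfModules.forget _).obj F))
    (hinj : Presheaf.IsLocallyInjective (Opens.grothendieckTopology (TopCat.of X))
      ((PresheafOfModules.toPresheaf _).map ψ))
    (hsurj : Presheaf.IsLocallySurjective (Opens.grothendieckTopology (TopCat.of X))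
      ((PresheafOfModules.toPresheaf _).map ψ)) :
    IsIso ((PresheafOfModules.sheafificationHomEquiv (𝟙 (holSheaf X).obj)).symm ψ) := by
  set g := (PresheafOfModules.sheafificationHomEquiv (𝟙 (holSheaf X).obj)).symm ψ with hg
  have e := PresheafOfModules.toPresheaf_map_sheafificationHomEquiv_def (𝟙 (holSheaf X).obj) g
  rw [hg, Equiv.apply_symm_apply] at e
  have hψ := (Opens.grothendieckTopology (TopCat.of X)).W_of_isLocallyBijective
    ((PresheafOfModules.toPresheaf _).map ψ)
  rw [e] at hψ
  -- ψ is the sheafification map followed by `g`. Both ψ and the sheafification map become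
  -- invertible on sheafifying, hence so does `g`; between sheaves this means that `g` is an
  -- isomorphism.
  have h2 := MorphismProperty.of_precomp _ _ _
    ((Opens.grothendieckTopology (TopCat.of X)).W_toSheafify P.presheaf) hψ
  have h3 : IsIso ((SheafOfModules.toSheaf _).map g) :=
    (GrothendieckTopology.W_sheafToPresheaf_map_iff_isIso _ _).1 h2
  exact isIso_of_reflects_iso g (SheafOfModules.toSheaf (holSheaf X))

end Sheafification

/-! ### The isomorphism of 𝒜_E with V ×_{TX} At(E). -/

section FibreProduct
open HolVB
variable {X : Type u} [TopologicalSpace X] [ChartedSpace ℂ X] [IsManifold 𝓘(ℂ) ω X]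
variable {E V : HolVB.{u, u} X} (L : LieAlgebroid V)

namespace LieAlgebroid

variable (E) in
/-- The sheaf `V ×_{TX} At(E)`. -/
def fibSheaf : SheafOfModules.{u} (holSheaf X) :=
  mkSheaf.{u, u} (fun U => L.fibSec E U) (fun h => L.fibRes E h) (fun _ _ => rfl)
    (fun _ _ _ => rfl) (fun U s hs => fib_glue U s hs)

variable {L} [ConnectedSpace X] (hE : 0 < Module.finrank ℂ E.F) (hL : L.anchor ≠ 0)

/-- The morphism of presheaves `[P ⊗ v] ↦ (σ̂(P) v, ⟨v, P⟩)`. -/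
def presheafToFib : L.atiyahPresheaf E ⟶
    (PresheafOfModules.restrictScalars (𝟙 (holSheaf X).obj)).obj
      ((SheafOfModules.forget _).obj (L.fibSheaf E)) where
  app U := ModuleCat.ofHom (X := (L.atiyahPresheaf E).obj U)
    (Y := ((PresheafOfModules.restrictScalars (𝟙 (holSheaf X).obj)).obj
      ((SheafOfModules.forget _).obj (L.fibSheaf E))).obj U)
    { toFun := quotToFib hE hL U.unop
      map_add' := (quotToFib hE hL U.unop).map_add
      map_smul' := (quotToFib hE hL U.unop).map_smul }
  naturality := fun {U W} h => by
    ext s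
    exact quotToFib_res hE hL (leOfHom h.unop) s

/-- Each point has a neighbourhood with frames of both bundles, where the map is bijective; the same
neighbourhoods give local surjectivity. -/
lemma presheafToFib_locallyInjective :
    Presheaf.IsLocallyInjective (Opens.grothendieckTopology (TopCat.of X))
      ((PresheafOfModules.toPresheaf _).map (presheafToFib hE hL)) where
  equalizerSieve_mem := fun {U} s t h => by
    intro x hx
    obtain ⟨W, hxW, hW, ⟨e⟩, ⟨b⟩⟩ := exists_frames E V (⟨x, hx⟩ : U.unop)
    refine ⟨W, homOfLE hW, ?_, hxW⟩
    refine (quotToFib_bijective hE hL e b).1 ?_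
    refine (quotToFib_res hE hL hW s).trans (Eq.trans ?_ (quotToFib_res hE hL hW t).symm)
    exact congrArg (L.fibRes E hW) h

lemma presheafToFib_locallySurjective :
    Presheaf.IsLocallySurjective (Opens.grothendieckTopology (TopCat.of X))
      ((PresheafOfModules.toPresheaf _).map (presheafToFib hE hL)) where
  imageSieve_mem := fun {U} s => by
    intro x hx
    obtain ⟨W, hxW, hW, ⟨e⟩, ⟨b⟩⟩ := exists_frames E V (⟨x, hx⟩ : U)
    obtain ⟨t, ht⟩ := (quotToFib_bijective hE hL e b).2 (L.fibRes E hW s)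
    exact ⟨W, homOfLE hW, ⟨t, ht⟩, hxW⟩

/-- The morphism `𝒜_E → V ×_{TX} At(E)`. -/
def atiyahToFib : L.atiyah E ⟶ L.fibSheaf E :=
  (PresheafOfModules.sheafificationHomEquiv (𝟙 (holSheaf X).obj)).symm (presheafToFib hE hL)

lemma isIso_atiyahToFib : IsIso (atiyahToFib hE hL) :=
  isIso_of_locallyBijective _ (presheafToFib_locallyInjective hE hL)
    (presheafToFib_locallySurjective hE hL)

/-- The isomorphism `𝒜_E ≅ V ×_{TX} At(E)`. -/
def atiyahIsoFib : L.atiyah E ≅ L.fibSheaf E :=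
  @asIso _ _ _ _ (atiyahToFib hE hL) (isIso_atiyahToFib hE hL)

/-- A section of the sheaf `V ×_{TX} At(E)` as a pair. -/
def ofSecs {U : Opens X} (s : secs (L.fibSheaf E) U) : L.fibSec E U := s

/-- The isomorphism is the adjoint of the presheaf map, so composed with the unit it gives that map
back. All later formulas on classes are checked through this one. -/
lemma atiyahIsoFib_cls {U : Opens X} (P : L.DiffOne E U) (v : V.sec U) :
    (ofSecs (onSecs (atiyahIsoFib hE hL).hom (L.cls E P v))).1 =
      (L.sig hE hL U P • v, DiffOp.contract P.toOp v) := by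
  have e := (PresheafOfModules.sheafificationHomEquiv (𝟙 (holSheaf X).obj)).apply_symm_apply
    (presheafToFib hE hL)
  rw [← PresheafOfModules.sheafificationAdjunction_homEquiv_apply, Adjunction.homEquiv_unit] at e
  have e2 := congrArg (fun k => (ModuleCat.Hom.hom (PresheafOfModules.Hom.app k (op U)))
    (L.quotCls P v)) e
  exact congrArg Subtype.val e2

end LieAlgebroid
end FibreProduct

/-! ### Exactness and local freeness tested on sections. -/

section SheafMorphisms
open HolVB
variable {X : Type u} [TopologicalSpace X] [ChartedSpace ℂ X]
variable {M N K : SheafOfModules.{u} (holSheaf X)}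

lemma sheafHom_ext {f g : M ⟶ N} (h : ∀ (U : Opens X) (s : secs M U), onSecs f s = onSecs g s) :
    f = g := by
  refine SheafOfModules.hom_ext (PresheafOfModules.hom_ext fun U => ?_)
  ext s
  exact h U.unop s

lemma onSecs_comp (f : M ⟶ N) (g : N ⟶ K) {U : Opens X} (s : secs M U) :
    onSecs (f ≫ g) s = onSecs g (onSecs f s) := rfl

lemma onSecs_id {U : Opens X} (s : secs M U) : onSecs (𝟙 M) s = s := rfl

lemma onSecs_res (f : M ⟶ N) {W U : Opens X} (h : W ≤ U) (s : secs M U) :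
    onSecs f (secsRes M h s) = secsRes N h (onSecs f s) :=
  PresheafOfModules.naturality_apply f.val (homOfLE h).op s

/-- The linear map on sections over `U` of a morphism. -/
def onSecsL (f : M ⟶ N) (U : Opens X) : secs M U →ₗ[(holSheaf X).obj.obj (op U)] secs N U :=
  (f.val.app (op U)).hom

lemma onSecs_add (f : M ⟶ N) {U : Opens X} (s t : secs M U) :
    onSecs f (s + t) = onSecs f s + onSecs f t := map_add (onSecsL f U) s t

lemma onSecs_smul (f : M ⟶ N) {U : Opens X} (a : (holSheaf X).obj.obj (op U)) (s : secs M U) :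
    onSecs f (a • s) = a • onSecs f s := map_smul (onSecsL f U) a s

lemma onSecs_zero {U : Opens X} (s : secs M U) : onSecs (0 : M ⟶ N) s = 0 := rfl

lemma onSecs_inv_hom (e : M ≅ N) {U : Opens X} (s : secs N U) :
    onSecs e.hom (onSecs e.inv s) = s := by
  rw [← onSecs_comp, e.inv_hom_id, onSecs_id]

lemma onSecs_hom_inv (e : M ≅ N) {U : Opens X} (s : secs M U) :
    onSecs e.inv (onSecs e.hom s) = s := by
  rw [← onSecs_comp, e.hom_inv_id, onSecs_id]

lemma onSecs_iso_injective (e : M ≅ N) {U : Opens X} :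
    Function.Injective (onSecs e.hom : secs M U → secs N U) :=
  Function.LeftInverse.injective (g := onSecs e.inv) (onSecs_hom_inv e)

lemma finrank_hom (E : HolVB.{u, u} X) :
    Module.finrank ℂ (E.Hom E).F = Module.finrank ℂ E.F ^ 2 := by
  have h := (LinearMap.toContinuousLinearMap (𝕜 := ℂ) (E := E.F) (F' := E.F)).finrank_eq
  rw [Module.finrank_linearMap, ← sq] at h
  exact h.symm

/-- A short exact sequence of sheaves from exactness on sections. -/
lemma shortExact_of_sections (f : M ⟶ N) (g : N ⟶ K) (w : f ≫ g = 0)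
    (hf : ∀ U : Opens X, Function.Injective (onSecs f : secs M U → secs N U))
    (hex : ∀ (U : Opens X) (s : secs N U), onSecs g s = 0 → ∃ t, onSecs f t = s)
    (hg : ∀ (U : Opens X) (s : secs K U) (x : U), ∃ (W : Opens X) (h : W ≤ U), x.1 ∈ W ∧
      ∃ t, onSecs g t = secsRes K h s) : (ShortComplex.mk f g w).ShortExact := by
  have hm : Mono f := ⟨fun a b h => sheafHom_ext fun U s => hf U <| by
    rw [← onSecs_comp, ← onSecs_comp, h]⟩
  have hs : Sheaf.IsLocallySurjective ((SheafOfModules.toSheaf (holSheaf X)).map g) :=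
    ⟨fun {U} s x hx => by
      obtain ⟨W, hW, hxW, t, ht⟩ := hg U s ⟨x, hx⟩
      exact ⟨W, homOfLE hW, ⟨t, ht⟩, hxW⟩⟩
  have he : Epi g := by
    have : Epi ((SheafOfModules.toSheaf (holSheaf X)).map g) :=
      Sheaf.epi_of_isLocallySurjective _
    exact (SheafOfModules.toSheaf (holSheaf X)).epi_of_epi_map this
  -- The lifts through `f` exist section by section; injectivity of `f` makes them unique, hence
  -- linear and compatible with restriction.
  have hk : Limits.IsLimit (Limits.KernelFork.ofι f w) :=
    Limits.KernelFork.IsLimit.ofι' f w fun {A} k hk => by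
      have key : ∀ (U : Opens X) (s : secs A U), ∃ t, onSecs f t = onSecs k s := fun U s =>
        hex U _ <| by rw [← onSecs_comp, hk, onSecs_zero]
      choose l hl using key
      refine ⟨mkHom (fun U =>
        { toFun := l U
          map_add' := fun s t => hf U <| by
            rw [onSecs_add, hl, hl, hl, onSecs_add]
          map_smul' := fun a s => hf U <| by
            rw [RingHom.id_apply, onSecs_smul, hl, hl, onSecs_smul] }) (fun {W U} h s => hf W <| by
            rw [onSecs_res]
            refine (hl W _).trans ?_
            rw [onSecs_res]
            exact congrArg _ (hl U s).symm), sheafHom_ext fun U s => hl U s⟩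
  exact { exact := ShortComplex.exact_of_f_is_kernel _ hk, mono_f := hm, epi_g := he }

lemma IsLocallyFreeOfRank.of_iso {n : ℕ} (hN : IsLocallyFreeOfRank N n) (e : M ≅ N) :
    IsLocallyFreeOfRank M n := fun x => by
  obtain ⟨U, hx, b, hb⟩ := hN x
  refine ⟨U, hx, fun i => onSecs e.inv (b i), fun W h => ?_⟩
  obtain ⟨B, hB⟩ := hb W h
  let l : secs N W ≃ₗ[(holSheaf X).obj.obj (op W)] secs M W :=
    LinearEquiv.ofBijective (onSecsL e.inv W)
      ⟨Function.LeftInverse.injective (g := onSecs e.hom) (onSecs_inv_hom e),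
        Function.RightInverse.surjective (g := onSecs e.hom) (onSecs_hom_inv e)⟩
  refine ⟨B.map l, fun i => ?_⟩
  rw [Module.Basis.map_apply, hB, ← onSecs_res]
  rfl

end SheafMorphisms

/-! ### The classical sequence and the sequence of the fibre product. -/

section AtiyahSequence
open HolVB
variable {X : Type u} [TopologicalSpace X] [ChartedSpace ℂ X] [IsManifold 𝓘(ℂ) ω X]
variable {E V : HolVB.{u, u} X}

/-- The symbol of sections of `At(E)`. -/
def atSymbol (hE : 0 < Module.finrank ℂ E.F) (U : Opens X) :
    atSec E U →ₗ[holFun U] (tangent X).sec U where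
  toFun P := (DiffOp.exists_isSymbol hE P.2).choose
  map_add' P Q := DiffOp.IsSymbol.unique hE (DiffOp.exists_isSymbol hE (P + Q).2).choose_spec
    ((DiffOp.exists_isSymbol hE P.2).choose_spec.add (DiffOp.exists_isSymbol hE Q.2).choose_spec)
  map_smul' f P := DiffOp.IsSymbol.unique hE (DiffOp.exists_isSymbol hE (f • P).2).choose_spec
    ((DiffOp.exists_isSymbol hE P.2).choose_spec.smul f)

lemma atSymbol_spec (hE : 0 < Module.finrank ℂ E.F) {U : Opens X} (P : atSec E U) :
    P.1.IsSymbol (atSymbol hE U P) := (DiffOp.exists_isSymbol hE P.2).choose_spec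

lemma atSymbol_eq_iff (hE : 0 < Module.finrank ℂ E.F) {U : Opens X} (P : atSec E U)
    (ξ : (tangent X).sec U) : atSymbol hE U P = ξ ↔ P.1.IsSymbol ξ :=
  ⟨fun h => h ▸ atSymbol_spec hE P, fun h => (atSymbol_spec hE P).unique hE h⟩

/-- The symbol `σ₀ : At(E) → TX`. -/
def atSymbolHom (hE : 0 < Module.finrank ℂ E.F) : atSheaf E ⟶ (tangent X).sheaf :=
  mkHom (M := atSheaf E) (N := (tangent X).sheaf) (fun U => atSymbol hE U)
    fun h P => (atSymbol_eq_iff hE (atRes E h P) _).2 ((atSymbol_spec hE P).res h)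

lemma endToAt_comp_symbol (hE : 0 < Module.finrank ℂ E.F) : endToAt E ≫ atSymbolHom hE = 0 :=
  sheafHom_ext fun U A => (atSymbol_eq_iff hE _ 0).2 (DiffOp.isSymbol_ofHom (E := E) (U := U) A)

lemma at_shortExact (hE : 0 < Module.finrank ℂ E.F) :
    (ShortComplex.mk (endToAt E) (atSymbolHom hE) (endToAt_comp_symbol hE)).ShortExact := by
  refine shortExact_of_sections _ _ _ (fun U A B h => ?_) (fun U P hP => ?_) (fun U ξ x => ?_)
  · exact DiffOp.ofHom_injective (E := E) (G := E) (U := U) (congrArg Subtype.val h)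
  · obtain ⟨A, hA⟩ := ((atSymbol_eq_iff hE P 0).1 hP).exists_ofHom
    exact ⟨A, Subtype.ext hA⟩
  · obtain ⟨W, hx, hW, ⟨b⟩⟩ := exists_frame E x
    have hs := b.flat_isSymbol (HolVB.res hW (show (tangent X).sec U from ξ))
    refine ⟨W, hW, hx, (⟨_, fun y => ⟨_, hs y⟩⟩ : atSec E W), ?_⟩
    exact (atSymbol_eq_iff hE _ _).2 hs

namespace LieAlgebroid
variable (L : LieAlgebroid V)

variable (E) in
/-- The inclusion `End(E) → V ×_{TX} At(E)`. -/
def endToFibHom : (E.Hom E).sheaf ⟶ L.fibSheaf E :=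
  mkHom (M := (E.Hom E).sheaf) (N := L.fibSheaf E) (fun U => L.endToFib U) fun _ _ => rfl

variable (E) in
/-- The projection `V ×_{TX} At(E) → V`. -/
def fibToV : L.fibSheaf E ⟶ V.sheaf :=
  mkHom (M := L.fibSheaf E) (N := V.sheaf)
    (fun U => ((LinearMap.fst (holFun U) (V.sec U) (DiffOp E E U)).comp (L.fibSec E U).subtype :
      L.fibSec E U →ₗ[holFun U] V.sec U)) fun _ _ => rfl

variable (E) in
/-- The projection `V ×_{TX} At(E) → At(E)`. -/
def fibToAt : L.fibSheaf E ⟶ atSheaf E :=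
  mkHom (M := L.fibSheaf E) (N := atSheaf E)
    (fun U => (((LinearMap.snd (holFun U) (V.sec U) (DiffOp E E U)).comp
      (L.fibSec E U).subtype).codRestrict (atSec E U) fun p x => ⟨_, p.2 x⟩ :
        L.fibSec E U →ₗ[holFun U] atSec E U)) fun _ _ => rfl

variable {L}

lemma endToFib_comp_fibToV : L.endToFibHom E ≫ L.fibToV E = 0 := rfl

lemma fib_shortExact :
    (ShortComplex.mk (L.endToFibHom E) (L.fibToV E) endToFib_comp_fibToV).ShortExact := by
  refine shortExact_of_sections _ _ _ (fun U A B h => ?_) (fun U p hp => ?_) (fun U v x => ?_)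
  · exact DiffOp.ofHom_injective (E := E) (G := E) (U := U)
      (congrArg (fun q : L.fibSec E U => q.1.2) h)
  · have key : ∀ q : L.fibSec E U, q.1.1 = 0 → ∃ A, L.endToFib U A = q := by
      rintro ⟨⟨v, Q⟩, hQ⟩ (rfl : v = 0)
      have hQ' : Q.IsSymbol (L.anch U 0) := hQ
      rw [map_zero] at hQ'
      obtain ⟨A, hA⟩ := hQ'.exists_ofHom
      exact ⟨A, Subtype.ext (Prod.ext rfl hA)⟩
    exact key p hp
  · obtain ⟨W, hx, hW, ⟨b⟩⟩ := exists_frame E x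
    exact ⟨W, hW, hx, L.frameToFib b (HolVB.res hW (show V.sec U from v), 0),
      congrArg Prod.fst (frameToFib_apply b _ 0)⟩

/-- The defining condition of the fibre product: Q has symbol φ(v). -/
lemma fibToAt_comp_symbol (hE : 0 < Module.finrank ℂ E.F) :
    L.fibToAt E ≫ atSymbolHom hE = L.fibToV E ≫ L.anchorHom :=
  sheafHom_ext fun U p => (atSymbol_eq_iff hE _ _).2 (show L.fibSec E U from p).2

lemma fib_isLocallyFree :
    IsLocallyFreeOfRank (L.fibSheaf E) (Module.finrank ℂ E.F ^ 2 + Module.finrank ℂ V.F) := by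
  intro x
  obtain ⟨U₁, hx₁, -, ⟨e₁⟩, ⟨b₁⟩⟩ := exists_frames E V (⟨x, trivial⟩ : (⊤ : Opens X))
  obtain ⟨U, hx, hU, ⟨c⟩⟩ := exists_frame (E.Hom E) (⟨x, hx₁⟩ : U₁)
  let e := e₁.res hU
  let b := b₁.res hU
  -- The frame of V is listed before that of End(E), so the sum is commuted to reach the stated
  -- rank.
  let τ : Fin (Module.finrank ℂ V.F) ⊕ Fin (Module.finrank ℂ (E.Hom E).F) ≃
      Fin (Module.finrank ℂ E.F ^ 2 + Module.finrank ℂ V.F) :=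
    finSumFinEquiv.trans (finCongr (by rw [finrank_hom, add_comm]))
  let t : Fin (Module.finrank ℂ E.F ^ 2 + Module.finrank ℂ V.F) → L.fibSec E U := fun i =>
    L.frameToFib e (Sum.elim (fun i => (b.vec i, 0)) (fun j => (0, c.vec j)) (τ.symm i))
  suffices H : ∀ (W : Opens X) (h : W ≤ U), ∃ B : Module.Basis _ (holFun W) (L.fibSec E W),
      ∀ i, B i = L.fibRes E h (t i) from ⟨U, hx, t, H⟩
  intro W h
  refine ⟨(((b.res h).basis.prod (c.res h).basis).map (L.frameToFib (e.res h))).reindex τ,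
    fun i => ?_⟩
  obtain ⟨i, rfl⟩ := τ.surjective i
  simp only [t, Module.Basis.reindex_apply, Equiv.symm_apply_apply, Module.Basis.map_apply,
    Module.Basis.prod_apply]
  cases i with
  | inl i =>
    rw [Sum.elim_inl, Sum.elim_inl]
    refine Eq.trans ?_ (frameToFib_res e h (b.vec i) 0)
    simp only [Function.comp, LinearMap.inl_apply, Frame.basis_apply, map_zero]
    rfl
  | inr i =>
    rw [Sum.elim_inr, Sum.elim_inr]
    refine Eq.trans ?_ (frameToFib_res e h 0 (c.vec i))
    simp only [Function.comp, LinearMap.inr_apply, Frame.basis_apply, map_zero]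
    rfl

end LieAlgebroid
end AtiyahSequence

/-! ### Connections as splittings. -/

section Connections
open HolVB
variable {X : Type u} [TopologicalSpace X] [ChartedSpace ℂ X] [IsManifold 𝓘(ℂ) ω X]
variable {E V : HolVB.{u, u} X} {L : LieAlgebroid V}

namespace LieAlgebroid

lemma Connection.ext_op {D D' : L.Connection E} (h : D.op = D'.op) : D = D' := by
  cases D
  cases D'
  cases h
  rfl

/-- The splitting `v ↦ (v, ⟨v, D⟩)` of `V ×_{TX} At(E) → V`. -/
def Connection.toFibSec (D : L.Connection E) (U : Opens X) : V.sec U →ₗ[holFun U] L.fibSec E U :=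
  (LinearMap.prod LinearMap.id (DiffOp.contract (DiffOp.res le_top D.op))).codRestrict _ fun v => by
    have := HasSymbol.isSymbol_contract (D.hasSymbol U) v
    rw [one_smul] at this
    exact this

/-- The splitting `v ↦ (v, ⟨v, D⟩)` as a morphism of sheaves. -/
def Connection.toFib (D : L.Connection E) : V.sheaf ⟶ L.fibSheaf E :=
  mkHom (M := V.sheaf) (N := L.fibSheaf E) (fun U => D.toFibSec U) fun _ _ => rfl

lemma Connection.toFib_comp (D : L.Connection E) : D.toFib ≫ L.fibToV E = 𝟙 V.sheaf := rfl

lemma Connection.toFib_injective :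
    Function.Injective (Connection.toFib : L.Connection E → (V.sheaf ⟶ L.fibSheaf E)) :=
  fun D D' h => Connection.ext_op <| DiffOp.contract_ext (V := V) (G := E) fun W _ v => by
    have := congrArg (fun f : V.sheaf ⟶ L.fibSheaf E =>
      (ofSecs (onSecs f (U := W) (HolVB.toSecs v))).1.2) h
    exact this

/-- The At(E)-component of a splitting is 𝒪-linear in v, hence the contraction of one operator `D`.
Since the V-component is v itself, ⟨v, D⟩ has symbol φ(v), so D has coefficient 1, which is the
Leibniz rule. -/
lemma exists_toFib_eq (δ : V.sheaf ⟶ L.fibSheaf E) (hδ : δ ≫ L.fibToV E = 𝟙 V.sheaf) :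
    ∃ D : L.Connection E, D.toFib = δ := by
  let d : ∀ W : Opens X, V.sec W →ₗ[holFun W] L.fibSec E W := fun W => onSecsL δ W
  have hd : ∀ (W : Opens X) (v : V.sec W), (d W v).1.1 = v := fun W v =>
    congrArg (fun f : V.sheaf ⟶ V.sheaf => onSecs f (U := W) (HolVB.toSecs v)) hδ
  have hr : ∀ (W' W : Opens X) (k : W' ≤ W) (v : V.sec W),
      d W' (HolVB.res k v) = L.fibRes E k (d W v) := fun W' W k v =>
    onSecs_res δ k (HolVB.toSecs v)
  obtain ⟨D, hD⟩ := DiffOp.exists_contract_eq (E := E) (G := E) (V := V) (U := ⊤)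
    (fun W _ => ((LinearMap.snd (holFun W) (V.sec W) (DiffOp E E W)).comp
      (L.fibSec E W).subtype).comp (d W))
    (fun W' W k h v => congrArg (fun q : L.fibSec E W' => q.1.2) (hr W' W k v))
  have hs : L.HasSymbol E D 1 := L.hasSymbol_of_isSymbol fun W k v => by
    rw [hD W k v, map_one, one_smul]
    have : (d W v).1.2.IsSymbol (L.anch W (d W v).1.1) := (d W v).2
    rw [hd] at this
    exact this
  refine ⟨⟨D, fun W f s x => ?_⟩, sheafHom_ext fun U v => Subtype.ext (Prod.ext ?_ ?_)⟩
  · refine sub_eq_iff_eq_add'.1 ((hs ⟨x.1, trivial⟩ W le_top x.2 f s).trans (one_smul ℂ _))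
  · exact (hd U v).symm
  · exact hD U le_top v

variable [ConnectedSpace X] (hE : 0 < Module.finrank ℂ E.F) (hL : L.anchor ≠ 0)

/-- Connections are the same as splittings of `𝒜_E → V`. -/
def connectionEquiv : L.Connection E ≃ {δ : V.sheaf ⟶ L.atiyah E //
    δ ≫ (atiyahIsoFib hE hL).hom ≫ L.fibToV E = 𝟙 V.sheaf} :=
  Equiv.ofBijective (fun D => ⟨D.toFib ≫ (atiyahIsoFib hE hL).inv, by
      rw [Category.assoc, Iso.inv_hom_id_assoc, D.toFib_comp]⟩) <| by
    constructor
    · intro D D' h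
      exact D.toFib_injective ((cancel_mono _).1 (congrArg Subtype.val h))
    · rintro ⟨δ, hδ⟩
      obtain ⟨D, hD⟩ := exists_toFib_eq (δ ≫ (atiyahIsoFib hE hL).hom)
        ((Category.assoc _ _ _).trans hδ)
      refine ⟨D, Subtype.ext ?_⟩
      dsimp only
      rw [hD, Category.assoc, Iso.hom_inv_id, Category.comp_id]

/-- Both sides become (v, ⟨v, D⟩) in the fibre product, because σ̂(D) = 1. -/
lemma connectionEquiv_apply (D : L.Connection E) (U : Opens X) (v : V.sec U) :
    onSecs (connectionEquiv hE hL D).1 (HolVB.toSecs v) = L.cls E (D.restrict U) v := by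
  refine onSecs_iso_injective (atiyahIsoFib hE hL) (Subtype.ext ?_)
  refine Eq.trans ?_ (atiyahIsoFib_cls hE hL (D.restrict U) v).symm
  rw [sig_eq hE hL (P := D.restrict U) (D.hasSymbol U), one_smul]
  exact congrArg (fun s => (ofSecs s).1) (onSecs_inv_hom (atiyahIsoFib hE hL) (onSecs D.toFib _))

end LieAlgebroid
end Connections

end RiemannSurface

end
-- Transport from the fibre product to 𝒜_E.
open RiemannSurface

theorem lemma3p5 {X : Type u} [TopologicalSpace X] [T2Space X] [CompactSpace X] [ConnectedSpace X]
    [ChartedSpace ℂ X] [IsManifold 𝓘(ℂ) ω X] (E V : HolVB.{u, u} X)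
    (hE : 0 < Module.finrank ℂ E.F) (L : LieAlgebroid V) (hφ : L.anchor ≠ 0) :
    -- `𝒜_E` is a vector bundle
    IsLocallyFreeOfRank (L.atiyah E) (Module.finrank ℂ E.F ^ 2 + Module.finrank ℂ V.F) ∧
    -- the inclusion of `End(E)`, the projections `ρ` and `σ₀`, and the morphism `𝒜_E → At(E)`
    ∃ (j : (E.Hom E).sheaf ⟶ L.atiyah E) (ρ : L.atiyah E ⟶ V.sheaf)
      (σ₀ : atSheaf E ⟶ (HolVB.tangent X).sheaf) (Φ : L.atiyah E ⟶ atSheaf E),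
      -- `j` is induced by `A ⊗ β ⊗ v ↦ (A ⊗ β) ⊗ v` and the trace `A ⊗ β ⊗ v ↦ β(v) A`
      (∀ (U : Opens X) (A : (E.Hom E).sec U) (β : (V.Hom (HolVB.trivial X)).sec U) (v : V.sec U),
        onSecs j (HolVB.toSecs (HolVB.pair β v • A)) = L.cls E (L.endTens E A β) v) ∧
      -- `ρ` is induced by `σ ⊗ Id_V`
      (∀ (U : Opens X) (P : L.DiffOne E U) (f : holFun U) (v : V.sec U),
        L.HasSymbol E P.toOp f → onSecs ρ (L.cls E P v) = HolVB.toSecs (f • v)) ∧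
      -- `σ₀` is the symbol
      (∀ (U : Opens X) (P : secs (atSheaf E) U) (ξ : (HolVB.tangent X).sec U),
        onSecs σ₀ P = HolVB.toSecs ξ ↔
          ∀ x : U, (atOp P).HasSymbolAt x fun α e => α (ξ.1 x) • e) ∧
      -- `Φ` is induced by the contraction of `V` with `V^*`
      (∀ (U : Opens X) (P : L.DiffOne E U) (v : V.sec U) (W : Opens X) (h : W ≤ U)
        (s : E.sec W) (x : W),
        ((atOp (onSecs Φ (L.cls E P v))).toFun W h s).1 x =
          HolVB.homAt (P.toOp.toFun W h s) x (v.1 ⟨x.1, h x.2⟩)) ∧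
      -- the exact sequences and the morphism between them
      (∃ hj : j ≫ ρ = 0, (ShortComplex.mk j ρ hj).ShortExact) ∧
      (∃ hi : endToAt E ≫ σ₀ = 0, (ShortComplex.mk (endToAt E) σ₀ hi).ShortExact) ∧
      j ≫ Φ = endToAt E ∧
      Φ ≫ σ₀ = ρ ≫ L.anchorHom ∧
      -- connections are the same as splittings
      ∃ e : L.Connection E ≃ {δ : V.sheaf ⟶ L.atiyah E // δ ≫ ρ = 𝟙 V.sheaf},
        (∀ (D : L.Connection E) (U : Opens X) (v : V.sec U),
          onSecs (e D).1 (HolVB.toSecs v) = L.cls E (D.restrict U) v) ∧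
        (∀ (δ : {δ : V.sheaf ⟶ L.atiyah E // δ ≫ ρ = 𝟙 V.sheaf}) (U : Opens X) (v : V.sec U)
          (W : Opens X) (h : W ≤ U) (s : E.sec W) (x : W),
          HolVB.homAt ((e.symm δ).op.toFun W le_top s) x (v.1 ⟨x.1, h x.2⟩) =
            ((atOp (onSecs Φ (onSecs δ.1 (HolVB.toSecs v)))).toFun W h s).1 x) := by
  have hs : ∀ {U : Opens X} (P : L.DiffOne E U) (v : V.sec U),
      (LieAlgebroid.ofSecs (onSecs (LieAlgebroid.atiyahIsoFib hE hφ).hom (L.cls E P v))).1 =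
        (L.sig hE hφ U P • v, DiffOp.contract P.toOp v) :=
    fun P v => LieAlgebroid.atiyahIsoFib_cls hE hφ P v
  have hjρ : (L.endToFibHom E ≫ (LieAlgebroid.atiyahIsoFib hE hφ).inv) ≫
      (LieAlgebroid.atiyahIsoFib hE hφ).hom ≫ L.fibToV E = 0 := by
    rw [Category.assoc, Iso.inv_hom_id_assoc]
    exact LieAlgebroid.endToFib_comp_fibToV
  refine ⟨LieAlgebroid.fib_isLocallyFree.of_iso (LieAlgebroid.atiyahIsoFib hE hφ),
    L.endToFibHom E ≫ (LieAlgebroid.atiyahIsoFib hE hφ).inv,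
    (LieAlgebroid.atiyahIsoFib hE hφ).hom ≫ L.fibToV E, atSymbolHom hE,
    (LieAlgebroid.atiyahIsoFib hE hφ).hom ≫ L.fibToAt E, ?_, ?_, ?_, ?_, ⟨hjρ, ?_⟩,
    ⟨endToAt_comp_symbol hE, at_shortExact hE⟩, ?_, ?_, LieAlgebroid.connectionEquiv hE hφ,
    LieAlgebroid.connectionEquiv_apply hE hφ, ?_⟩
  · intro U A β v
    -- Compared in the fibre product, both sides are the pair (0, β(v) A).
    refine onSecs_iso_injective (LieAlgebroid.atiyahIsoFib hE hφ) (Subtype.ext ?_)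
    refine Eq.trans ?_ (hs (L.endTens E A β) v).symm
    rw [LieAlgebroid.sig_endTens, zero_smul, LieAlgebroid.contract_endTens]
    exact congrArg (fun s => (LieAlgebroid.ofSecs s).1)
      (onSecs_inv_hom (LieAlgebroid.atiyahIsoFib hE hφ) (onSecs (L.endToFibHom E) _))
  · intro U P f v hf
    rw [← LieAlgebroid.sig_eq hE hφ hf]
    exact congrArg Prod.fst (hs P v)
  · intro U P ξ
    exact atSymbol_eq_iff hE P ξ
  · intro U P v W h s x
    exact congrArg (fun Q : V.sec U × DiffOp E E U => (Q.2.toFun W h s).1 x) (hs P v)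
  · refine ShortComplex.shortExact_of_iso ?_ (LieAlgebroid.fib_shortExact (E := E) (L := L))
    exact ShortComplex.isoMk (Iso.refl _) (LieAlgebroid.atiyahIsoFib hE hφ).symm (Iso.refl _)
      (by simp) (by simp)
  · rw [Category.assoc, Iso.inv_hom_id_assoc]
    rfl
  · rw [Category.assoc, Category.assoc, LieAlgebroid.fibToAt_comp_symbol]
  · intro δ U v W h s x
    -- Once δ comes from a connection D, δ(v) = [D ⊗ v], and the claim is the contraction formula
    -- for that class.
    obtain ⟨D, rfl⟩ := (LieAlgebroid.connectionEquiv hE hφ).surjective δ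
    rw [Equiv.symm_apply_apply, LieAlgebroid.connectionEquiv_apply]
    exact (congrArg (fun Q : V.sec U × DiffOp E E U => (Q.2.toFun W h s).1 x)
      (hs (D.restrict U) v)).symm
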